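/- Let $c>1$ and $d>0$ be real numbers and let $a=d\,\mathbb 1_{[0,1]}$ on $(-1,1)$. Let $\mathcal H=(H^1_0(-1,1))^2\times(L^2(-1,1))^2$ be the (complex) energy space, with the norm $$\|(u^1,v^1,u^2,v^2)\|_{\mathcal H}^2=\int_{-1}^1\left(|u^1_x|^2+c\,|v^1_x|^2+|u^2|^2+|v^2|^2\right)dx ,$$ and let $\mathcal A$ be the operator on $\mathcal H$ given by $$\mathcal A(u^1,v^1,u^2,v^2)=\left(u^2,\;v^2,\;(u^1_x+a\,u^2_x)_x-v^2,\;c\,v^1_{xx}+u^2\right),$$ $$\mathcal D(\mathcal A)=\left\{(u^1,v^1,u^2,v^2)\in\mathcal H:\ u^2,v^2\in H^1_0(-1,1),\ v^1\in H^2(-1,1),\ (u^1_x+a\,u^2_x)_x\in L^2(-1,1)\right\}.$$ Assume that $\sin(2\sqrt c\,n\pi)$ is not $O(n^{-1/2})$ as $n\to\infty$, $n\in\mathbb N$. Then $\mathcal A$ generates a $C_0$-semigroup $(e^{t\mathcal A})_{t\ge 0}$ on $\mathcal H$, and this semigroup is not exponentially stable: there are no constants $M>0$ and $\alpha>0$ such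 that $\|e^{t\mathcal A}\|_{\mathcal L(\mathcal H)}\le M e^{-\alpha t}$ for all $t\ge 0$. -/

import Mathlib

open MeasureTheory Set Filter Topology Asymptotics
open scoped ContDiff NNReal

noncomputable section

namespace KVWave

/-- Lebesgue measure on the interval `(-1, 1)`. -/
abbrev mu : Measure ℝ := volume.restrict (Ioo (-1 : ℝ) 1)

/-- The complex Hilbert space `L²(-1, 1)`. -/
abbrev L2 : Type := Lp ℂ 2 mu

/-- `φ` is a (real) test function on `(-1, 1)`: an element of `C_c^∞(-1, 1)`. -/
def IsTest (φ : ℝ → ℝ) : Prop :=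
  ContDiff ℝ ∞ φ ∧ HasCompactSupport φ ∧ tsupport φ ⊆ Ioo (-1 : ℝ) 1

/-- `g` is the weak derivative of `f` on `(-1, 1)`. -/
def IsWeakDeriv (f g : L2) : Prop :=
  ∀ φ : ℝ → ℝ, IsTest φ → ∫ x, deriv φ x • f x ∂mu = -∫ x, φ x • g x ∂mu

theorem IsTest.deriv_test {φ : ℝ → ℝ} (h : IsTest φ) : IsTest (deriv φ) :=
  ⟨(contDiff_infty_iff_deriv.1 h.1).2, h.2.1.deriv, tsupport_deriv_subset.trans h.2.2⟩

theorem L2.integrable (f : L2) : Integrable f mu :=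
  (Lp.memLp f).integrable (by norm_num)

theorem IsTest.integrable_smul {φ : ℝ → ℝ} (h : IsTest φ) {f : ℝ → ℂ} (hf : Integrable f mu) :
    Integrable (fun x => φ x • f x) mu := by
  obtain ⟨C, hC⟩ := h.2.1.exists_bound_of_continuous h.1.continuous
  exact hf.bdd_smul C h.1.continuous.aestronglyMeasurable (Eventually.of_forall hC)

/-- A function which is orthogonal to all test functions vanishes. -/
theorem L2.eq_zero_of_test {f : ℝ → ℂ} (hf : Integrable f mu)
    (h : ∀ φ : ℝ → ℝ, IsTest φ → ∫ x, φ x • f x ∂mu = 0) : f =ᵐ[mu] 0 := by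
  have h2 := isOpen_Ioo.ae_eq_zero_of_integral_contDiff_smul_eq_zero (μ := (volume : Measure ℝ))
    (U := Ioo (-1 : ℝ) 1) (f := f) (IntegrableOn.locallyIntegrableOn hf) (by
      intro g g1 g2 g3
      have := h g ⟨g1, g2, g3⟩
      rw [← this]
      symm
      apply setIntegral_eq_integral_of_forall_compl_eq_zero
      intro x hx
      have : g x = 0 := image_eq_zero_of_notMem_tsupport (fun hh => hx (g3 hh))
      simp [this])
  exact (ae_restrict_iff' measurableSet_Ioo).2 h2

theorem IsWeakDeriv.unique {f g₁ g₂ : L2} (h₁ : IsWeakDeriv f g₁) (h₂ : IsWeakDeriv f g₂) :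
    g₁ = g₂ := by
  rw [← sub_eq_zero, Lp.eq_zero_iff_ae_eq_zero]
  apply L2.eq_zero_of_test (L2.integrable _)
  intro φ hφ
  have e : ∫ x, φ x • (g₁ - g₂ : L2) x ∂mu = ∫ x, (φ x • g₁ x - φ x • g₂ x) ∂mu := by
    apply integral_congr_ae
    filter_upwards [Lp.coeFn_sub g₁ g₂] with x hx
    rw [hx, Pi.sub_apply, smul_sub]
  rw [e, integral_sub (hφ.integrable_smul g₁.integrable) (hφ.integrable_smul g₂.integrable)]
  have := (h₁ φ hφ).symm.trans (h₂ φ hφ)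
  rw [neg_inj] at this
  rw [this, sub_self]

theorem IsWeakDeriv.add {f₁ f₂ g₁ g₂ : L2} (h₁ : IsWeakDeriv f₁ g₁) (h₂ : IsWeakDeriv f₂ g₂) :
    IsWeakDeriv (f₁ + f₂) (g₁ + g₂) := by
  intro φ hφ
  have e : ∀ (ψ : ℝ → ℝ) (_ : IsTest ψ) (a b : L2), ∫ x, ψ x • (a + b : L2) x ∂mu =
      ∫ x, ψ x • a x ∂mu + ∫ x, ψ x • b x ∂mu := by
    intro ψ hψ a b
    rw [← integral_add (hψ.integrable_smul a.integrable) (hψ.integrable_smul b.integrable)]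
    apply integral_congr_ae
    filter_upwards [Lp.coeFn_add a b] with x hx
    rw [hx, Pi.add_apply, smul_add]
  rw [e _ hφ.deriv_test, e _ hφ, h₁ φ hφ, h₂ φ hφ, neg_add]

theorem IsWeakDeriv.smul {f g : L2} (r : ℂ) (h : IsWeakDeriv f g) :
    IsWeakDeriv (r • f) (r • g) := by
  intro φ hφ
  have e : ∀ (ψ : ℝ → ℝ) (a : L2), ∫ x, ψ x • (r • a : L2) x ∂mu =
      r • ∫ x, ψ x • a x ∂mu := by
    intro ψ a
    rw [← integral_smul]
    apply integral_congr_ae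
    filter_upwards [Lp.coeFn_smul r a] with x hx
    rw [hx, Pi.smul_apply, smul_comm]
  rw [e, e, h φ hφ, smul_neg]

theorem IsWeakDeriv.zero : IsWeakDeriv 0 0 := by
  intro φ hφ
  have e : ∀ ψ : ℝ → ℝ, ∫ x, ψ x • (0 : L2) x ∂mu = 0 := by
    intro ψ
    rw [← integral_zero ℝ ℂ (μ := mu)]
    apply integral_congr_ae
    filter_upwards [Lp.coeFn_zero ℂ 2 mu] with x hx
    rw [hx, Pi.zero_apply, smul_zero]
  rw [e, e, neg_zero]

/-- The Sobolev space `H¹(-1, 1)`. -/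
def H1 : Submodule ℂ L2 where
  carrier := {f | ∃ g, IsWeakDeriv f g}
  add_mem' := by
    rintro _ _ ⟨g, hg⟩ ⟨k, hk⟩
    exact ⟨g + k, hg.add hk⟩
  zero_mem' := ⟨0, IsWeakDeriv.zero⟩
  smul_mem' := by
    rintro r _ ⟨g, hg⟩
    exact ⟨r • g, hg.smul r⟩

/-- The weak derivative `f ↦ f_x`, as a linear map from `H¹(-1, 1)` to `L²(-1, 1)`. -/
def weakDeriv : H1 →ₗ[ℂ] L2 where
  toFun f := f.2.choose
  map_add' f g := (f + g).2.choose_spec.unique (f.2.choose_spec.add g.2.choose_spec)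
  map_smul' r f := (r • f).2.choose_spec.unique (f.2.choose_spec.smul r)

theorem weakDeriv_spec (f : H1) : IsWeakDeriv f (weakDeriv f) := f.2.choose_spec

/-- The Sobolev space `H¹₀(-1, 1)`: the elements of `H¹(-1, 1)` whose continuous representative
on `[-1, 1]` vanishes at both end points. -/
def H10 : Submodule ℂ L2 where
  carrier := {f | f ∈ H1 ∧ ∃ F : ℝ → ℂ, ContinuousOn F (Icc (-1) 1) ∧ f =ᵐ[mu] F ∧
    F (-1) = 0 ∧ F 1 = 0}
  add_mem' := by
    rintro f g ⟨hf, F, F1, F2, F3, F4⟩ ⟨hg, G, G1, G2, G3, G4⟩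
    refine ⟨H1.add_mem hf hg, F + G, F1.add G1, (Lp.coeFn_add f g).trans (F2.add G2), ?_, ?_⟩
    · simp [F3, G3]
    · simp [F4, G4]
  zero_mem' := ⟨H1.zero_mem, 0, continuousOn_const, Lp.coeFn_zero ℂ 2 mu, rfl, rfl⟩
  smul_mem' := by
    rintro r f ⟨hf, F, F1, F2, F3, F4⟩
    refine ⟨H1.smul_mem r hf, r • F, F1.const_smul r,
      (Lp.coeFn_smul r f).trans (F2.const_smul r), ?_, ?_⟩
    · simp [F3]
    · simp [F4]

theorem H10_le_H1 : H10 ≤ H1 := fun _ h => h.1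

/-- The weak derivative on `H¹₀(-1, 1)`. -/
def weakDeriv₀ : H10 →ₗ[ℂ] L2 := weakDeriv ∘ₗ Submodule.inclusion H10_le_H1

/-- The primitive of a test function of integral zero is a test function. -/
theorem IsTest.exists_primitive {χ : ℝ → ℝ} (h : IsTest χ) (h0 : ∫ x, χ x = 0) :
    ∃ φ, IsTest φ ∧ deriv φ = χ := by
  have hd : ∀ x, HasDerivAt (fun x => ∫ t in (-1 : ℝ)..x, χ t) (χ x) x := fun x =>
    intervalIntegral.integral_hasDerivAt_right (h.1.continuous.intervalIntegrable _ _)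
      (h.1.continuous.stronglyMeasurableAtFilter _ _) h.1.continuous.continuousAt
  have hdd : deriv (fun x => ∫ t in (-1 : ℝ)..x, χ t) = χ := funext fun x => (hd x).deriv
  -- the support of `χ` lies in some `[a, b] ⊆ (-1, 1)`
  obtain ⟨a, b, ha, hb, hab⟩ : ∃ a b : ℝ, -1 < a ∧ b < 1 ∧ tsupport χ ⊆ Icc a b := by
    rcases (tsupport χ).eq_empty_or_nonempty with he | hne
    · exact ⟨0, 0, by norm_num, by norm_num, by simp [he]⟩
    · have hc : IsCompact (tsupport χ) := h.2.1
      obtain ⟨a, ha, ha'⟩ := hc.exists_isLeast hne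
      obtain ⟨b, hb, hb'⟩ := hc.exists_isGreatest hne
      exact ⟨a, b, (h.2.2 ha).1, (h.2.2 hb).2, fun x hx => ⟨ha' hx, hb' hx⟩⟩
  have hz : ∀ x, x ∉ Icc a b → χ x = 0 := fun x hx =>
    image_eq_zero_of_notMem_tsupport fun hh => hx (hab hh)
  have hsupp : Function.support (fun x => ∫ t in (-1 : ℝ)..x, χ t) ⊆ Icc a b := by
    intro x hx
    by_contra hxn
    apply hx
    change ∫ t in (-1 : ℝ)..x, χ t = 0
    rw [mem_Icc, not_and_or, not_le, not_le] at hxn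
    rcases hxn with hxa | hxb
    · apply intervalIntegral.integral_zero_ae
      refine Eventually.of_forall fun t ht => hz t fun htt => ?_
      rcases le_max_iff.1 ht.2 with h1 | h1 <;> linarith [htt.1]
    · rw [← h0]
      apply intervalIntegral.integral_eq_integral_of_support_subset
      intro t ht
      have : t ∈ Icc a b := by
        by_contra hh
        exact ht (hz t hh)
      exact ⟨by linarith [this.1], by linarith [this.2]⟩
  have hts : tsupport (fun x => ∫ t in (-1 : ℝ)..x, χ t) ⊆ Icc a b :=
    closure_minimal hsupp isClosed_Icc
  refine ⟨_, ⟨?_, ?_, ?_⟩, hdd⟩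
  · rw [contDiff_infty_iff_deriv, hdd]
    exact ⟨fun x => (hd x).differentiableAt, h.1⟩
  · exact HasCompactSupport.of_support_subset_isCompact isCompact_Icc hsupp
  · exact hts.trans fun x hx => ⟨by linarith [hx.1], by linarith [hx.2]⟩

theorem exists_isTest_integral_one : ∃ ρ : ℝ → ℝ, IsTest ρ ∧ ∫ x, ρ x = 1 := by
  let b : ContDiffBump (0 : ℝ) := ⟨1 / 4, 1 / 2, by norm_num, by norm_num⟩
  refine ⟨b.normed volume, ⟨b.contDiff_normed, b.hasCompactSupport_normed, ?_⟩,
    b.integral_normed⟩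
  rw [b.tsupport_normed_eq, Real.closedBall_eq_Icc]
  intro x hx
  have h1 : b.rOut = 1 / 2 := rfl
  rw [h1] at hx
  exact ⟨by linarith [hx.1], by linarith [hx.2]⟩

/-- A function with vanishing weak derivative is constant. -/
theorem IsWeakDeriv.const_of_zero {f : L2} (h : IsWeakDeriv f 0) :
    ∃ C : ℂ, f =ᵐ[mu] fun _ => C := by
  obtain ⟨ρ, hρ, hρ1⟩ := exists_isTest_integral_one
  have h0 : ∀ φ : ℝ → ℝ, IsTest φ → ∫ x, deriv φ x • f x ∂mu = 0 := by
    intro φ hφ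
    rw [h φ hφ, neg_eq_zero, ← integral_zero ℝ ℂ (μ := mu)]
    apply integral_congr_ae
    filter_upwards [Lp.coeFn_zero ℂ 2 mu] with x hx
    rw [hx, Pi.zero_apply, smul_zero]
  refine ⟨∫ x, ρ x • f x ∂mu, ?_⟩
  set C : ℂ := ∫ x, ρ x • f x ∂mu with hC
  have hi : Integrable (fun x => f x - C) mu := f.integrable.sub (integrable_const C)
  have key : (fun x => f x - C) =ᵐ[mu] 0 := by
    apply L2.eq_zero_of_test hi
    intro ψ hψ
    have iρ : Integrable ρ := hρ.1.continuous.integrable_of_hasCompactSupport hρ.2.1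
    have iψ : Integrable ψ := hψ.1.continuous.integrable_of_hasCompactSupport hψ.2.1
    have hχ : IsTest (fun x => ψ x - (∫ t, ψ t) * ρ x) := by
      refine ⟨hψ.1.sub (contDiff_const.mul hρ.1), hψ.2.1.sub hρ.2.1.mul_left, ?_⟩
      refine (tsupport_sub ψ (fun x => (∫ t, ψ t) * ρ x)).trans (union_subset hψ.2.2 ?_)
      exact (tsupport_mul_subset_right (f := fun _ => ∫ t, ψ t) (g := ρ)).trans hρ.2.2
    obtain ⟨φ, hφ, hφd⟩ := hχ.exists_primitive (by
      rw [integral_sub iψ (iρ.const_mul _), integral_const_mul, hρ1, mul_one, sub_self])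
    have e1 := h0 φ hφ
    rw [hφd] at e1
    have e2 : ∫ x, ψ x ∂mu = ∫ x, ψ x :=
      setIntegral_eq_integral_of_forall_compl_eq_zero fun x hx =>
        image_eq_zero_of_notMem_tsupport fun hh => hx (hψ.2.2 hh)
    have e3 : ∫ x, (ψ x - (∫ t, ψ t) * ρ x) • f x ∂mu =
        ∫ x, ψ x • f x ∂mu - (∫ t, ψ t) • C := by
      have i2 : Integrable (fun x => (∫ t, ψ t) • ρ x • f x) mu :=
        (hρ.integrable_smul f.integrable).smul (∫ t, ψ t)
      rw [hC, ← integral_smul, ← integral_sub (hψ.integrable_smul f.integrable) i2]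
      congr 1
      funext x
      rw [sub_smul, mul_smul]
    rw [e3] at e1
    have e4 : ∫ x, ψ x • (f x - C) ∂mu = ∫ x, ψ x • f x ∂mu - (∫ t, ψ t) • C := by
      rw [← e2, ← integral_smul_const, ← integral_sub (hψ.integrable_smul f.integrable)
        (iψ.restrict.smul_const C)]
      simp_rw [smul_sub]
    rw [e4, e1]
  filter_upwards [key] with x hx
  exact sub_eq_zero.1 hx

theorem weakDeriv₀_injective : Function.Injective weakDeriv₀ := by
  rw [injective_iff_map_eq_zero]
  rintro ⟨f, hf, F, F1, F2, _, F4⟩ h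
  have hw : IsWeakDeriv f 0 := by
    have := weakDeriv_spec ⟨f, hf⟩
    rwa [show weakDeriv ⟨f, hf⟩ = 0 from h] at this
  obtain ⟨C, hC⟩ := hw.const_of_zero
  have hFC : F =ᵐ[mu] fun _ => C := F2.symm.trans hC
  have hEq : EqOn F (fun _ => C) (Icc (-1) 1) := by
    have h1 : F =ᵐ[volume.restrict (Icc (-1 : ℝ) 1)] fun _ => C := by
      rwa [Measure.restrict_congr_set Ioo_ae_eq_Icc.symm]
    exact Measure.eqOn_Icc_of_ae_eq volume (by norm_num) h1 F1 continuousOn_const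
  have hC0 : C = 0 := by
    rw [← F4]
    exact (hEq ⟨by norm_num, le_rfl⟩).symm
  apply Subtype.ext
  change f = 0
  rw [Lp.eq_zero_iff_ae_eq_zero]
  rw [hC0] at hC
  exact hC

/-- The parameters of the system: the squared speed `c > 0` of the second wave and the strength
`d > 0` of the damping of the first one. -/
structure Params where
  c : ℝ
  d : ℝ
  c_pos : 0 < c
  d_pos : 0 < d

/-- Multiplication by the damping coefficient `a = d 𝟙_{[0,1]}` on `L²(-1, 1)`. -/
def dampMul (p : Params) : L2 →ₗ[ℂ] L2 where
  toFun f := (p.d : ℂ) • (((Lp.memLp f).indicator (s := Icc (0 : ℝ) 1) measurableSet_Icc).toLp _)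
  map_add' f g := by
    rw [← smul_add, ← MemLp.toLp_add]
    congr 1
    apply MemLp.toLp_congr
    filter_upwards [Lp.coeFn_add f g] with x hx
    rw [Pi.add_apply] at hx ⊢
    by_cases h : x ∈ Icc (0 : ℝ) 1
    · simp only [indicator_of_mem h, hx]
    · simp only [indicator_of_notMem h, add_zero]
  map_smul' r f := by
    rw [RingHom.id_apply, smul_comm r]
    refine congrArg (fun k : L2 => (p.d : ℂ) • k) ?_
    rw [← MemLp.toLp_const_smul]
    apply MemLp.toLp_congr
    filter_upwards [Lp.coeFn_smul r f] with x hx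
    rw [Pi.smul_apply] at hx ⊢
    by_cases h : x ∈ Icc (0 : ℝ) 1
    · simp only [indicator_of_mem h, hx]
    · simp only [indicator_of_notMem h, smul_zero]

theorem dampMul_coeFn (p : Params) (f : L2) :
    dampMul p f =ᵐ[mu] fun x => (Icc (0 : ℝ) 1).indicator (fun _ => (p.d : ℂ)) x * f x := by
  filter_upwards [Lp.coeFn_smul (p.d : ℂ)
    (((Lp.memLp f).indicator (s := Icc (0 : ℝ) 1) measurableSet_Icc).toLp _),
    ((Lp.memLp f).indicator (s := Icc (0 : ℝ) 1) measurableSet_Icc).coeFn_toLp] with x h1 h2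
  change ((p.d : ℂ) • (((Lp.memLp f).indicator (s := Icc (0 : ℝ) 1)
    measurableSet_Icc).toLp _) : L2) x = _
  rw [h1, Pi.smul_apply, h2]
  by_cases h : x ∈ Icc (0 : ℝ) 1 <;> simp [h]

/-- The vector space underlying the energy space: `H¹₀ × H¹₀ × L² × L²` over `(-1, 1)`. It is
given its own name because it carries the energy inner product and not the product norm. -/
def Energy (_ : Params) : Type := H10 × H10 × L2 × L2

namespace Energy

variable {p : Params}

instance : AddCommGroup (Energy p) := inferInstanceAs (AddCommGroup (H10 × H10 × L2 × L2))

instance : Module ℂ (Energy p) := inferInstanceAs (Module ℂ (H10 × H10 × L2 × L2))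

/-- The four components of `y = (u¹, v¹, u², v²)`, as linear maps. -/
def u1 : Energy p →ₗ[ℂ] H10 := LinearMap.fst ℂ H10 (H10 × L2 × L2)

def v1 : Energy p →ₗ[ℂ] H10 :=
  LinearMap.fst ℂ H10 (L2 × L2) ∘ₗ LinearMap.snd ℂ H10 (H10 × L2 × L2)

def u2 : Energy p →ₗ[ℂ] L2 :=
  LinearMap.fst ℂ L2 L2 ∘ₗ LinearMap.snd ℂ H10 (L2 × L2) ∘ₗ LinearMap.snd ℂ H10 (H10 × L2 × L2)

def v2 : Energy p →ₗ[ℂ] L2 :=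
  LinearMap.snd ℂ L2 L2 ∘ₗ LinearMap.snd ℂ H10 (L2 × L2) ∘ₗ LinearMap.snd ℂ H10 (H10 × L2 × L2)

/-- The vector of the energy space with the given four components. -/
def ofComponents : (H10 × H10 × L2 × L2) →ₗ[ℂ] Energy p where
  toFun x := x
  map_add' _ _ := rfl
  map_smul' _ _ := rfl

theorem ext {x y : Energy p} (h1 : u1 x = u1 y) (h2 : v1 x = v1 y) (h3 : u2 x = u2 y)
    (h4 : v2 x = v2 y) : x = y :=
  Prod.ext h1 (Prod.ext h2 (Prod.ext h3 h4))

/-- The energy inner product. -/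
@[reducible]
def innerCore : InnerProductSpace.Core ℂ (Energy p) where
  inner x y := inner ℂ (weakDeriv₀ (u1 x)) (weakDeriv₀ (u1 y)) +
    (p.c : ℂ) * inner ℂ (weakDeriv₀ (v1 x)) (weakDeriv₀ (v1 y)) +
    inner ℂ (u2 x) (u2 y) + inner ℂ (v2 x) (v2 y)
  conj_inner_symm x y := by
    simp only [map_add, map_mul, inner_conj_symm, Complex.conj_ofReal]
  re_inner_nonneg x := by
    simp only [inner_self_eq_norm_sq_to_K, Complex.coe_algebraMap, ← Complex.ofReal_pow,
      ← Complex.ofReal_mul, ← Complex.ofReal_add]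
    rw [RCLike.re_eq_complex_re, Complex.ofReal_re]
    have := p.c_pos.le
    positivity
  add_left x y z := by
    simp only [map_add, inner_add_left]
    ring
  smul_left x y r := by
    simp only [map_smul, inner_smul_left]
    ring
  definite x hx := by
    simp only [inner_self_eq_norm_sq_to_K, Complex.coe_algebraMap, ← Complex.ofReal_pow,
      ← Complex.ofReal_mul, ← Complex.ofReal_add] at hx
    rw [Complex.ofReal_eq_zero] at hx
    have hc := p.c_pos
    have h1 := sq_nonneg ‖weakDeriv₀ (u1 x)‖
    have h2 := mul_nonneg hc.le (sq_nonneg ‖weakDeriv₀ (v1 x)‖)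
    have h3 := sq_nonneg ‖u2 x‖
    have h4 := sq_nonneg ‖v2 x‖
    have k1 : ‖weakDeriv₀ (u1 x)‖ ^ 2 = 0 := by linarith
    have k2 : p.c * ‖weakDeriv₀ (v1 x)‖ ^ 2 = 0 := by linarith
    have k3 : ‖u2 x‖ ^ 2 = 0 := by linarith
    have k4 : ‖v2 x‖ ^ 2 = 0 := by linarith
    replace k2 := (mul_eq_zero.1 k2).resolve_left hc.ne'
    rw [sq_eq_zero_iff, norm_eq_zero] at k1 k2 k3 k4
    apply Energy.ext
    · exact (weakDeriv₀_injective (k1.trans (map_zero _).symm)).trans (map_zero u1).symm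
    · exact (weakDeriv₀_injective (k2.trans (map_zero _).symm)).trans (map_zero v1).symm
    · exact k3.trans (map_zero u2).symm
    · exact k4.trans (map_zero v2).symm

instance : NormedAddCommGroup (Energy p) := innerCore.toNormedAddCommGroup

instance : InnerProductSpace ℂ (Energy p) := InnerProductSpace.ofCore innerCore.toCore

end Energy

/-- The domain `D(𝒜)`: all `(u¹, v¹, u², v²)` in the energy space such that `u²` and `v²` belong to
`H¹₀`, `v¹` belongs to `H²` (that is, `v¹ₓ ∈ H¹`) and `(u¹ₓ + a u²ₓ)ₓ` belongs to `L²` (that is,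
`u¹ₓ + a u²ₓ ∈ H¹`). -/
def waveDomain (p : Params) : Submodule ℂ (Energy p) where
  carrier := {y | ∃ (h : Energy.u2 y ∈ H10), Energy.v2 y ∈ H10 ∧
    weakDeriv₀ (Energy.v1 y) ∈ H1 ∧
    weakDeriv₀ (Energy.u1 y) + dampMul p (weakDeriv₀ ⟨Energy.u2 y, h⟩) ∈ H1}
  add_mem' := by
    rintro x y ⟨x1, x2, x3, x4⟩ ⟨y1, y2, y3, y4⟩
    refine ⟨by rw [map_add]; exact H10.add_mem x1 y1, by rw [map_add]; exact H10.add_mem x2 y2,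
      by rw [map_add, map_add]; exact H1.add_mem x3 y3, ?_⟩
    convert H1.add_mem x4 y4 using 1
    have e : (⟨Energy.u2 (x + y), by rw [map_add]; exact H10.add_mem x1 y1⟩ : H10) =
        ⟨Energy.u2 x, x1⟩ + ⟨Energy.u2 y, y1⟩ := Subtype.ext (map_add _ _ _)
    rw [e]
    simp only [map_add]
    abel
  zero_mem' := by
    refine ⟨by rw [map_zero]; exact H10.zero_mem, by rw [map_zero]; exact H10.zero_mem,
      by rw [map_zero, map_zero]; exact H1.zero_mem, ?_⟩
    have e : (⟨Energy.u2 (0 : Energy p), by rw [map_zero]; exact H10.zero_mem⟩ : H10) = 0 :=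
      Subtype.ext (map_zero _)
    rw [e]
    simp only [map_zero, add_zero]
    exact H1.zero_mem
  smul_mem' := by
    rintro r x ⟨x1, x2, x3, x4⟩
    refine ⟨by rw [map_smul]; exact H10.smul_mem r x1, by rw [map_smul]; exact H10.smul_mem r x2,
      by rw [map_smul, map_smul]; exact H1.smul_mem r x3, ?_⟩
    convert H1.smul_mem r x4 using 1
    have e : (⟨Energy.u2 (r • x), by rw [map_smul]; exact H10.smul_mem r x1⟩ : H10) =
        r • ⟨Energy.u2 x, x1⟩ := Subtype.ext (map_smul _ _ _)
    rw [e]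
    simp only [map_smul, smul_add]

section components

variable {p : Params}

/-- `u²` as an element of `H¹₀`, for `y ∈ D(𝒜)`. -/
def domU2 : waveDomain p →ₗ[ℂ] H10 :=
  LinearMap.codRestrict H10 (Energy.u2 ∘ₗ (waveDomain p).subtype) fun y => y.2.choose

/-- `v²` as an element of `H¹₀`, for `y ∈ D(𝒜)`. -/
def domV2 : waveDomain p →ₗ[ℂ] H10 :=
  LinearMap.codRestrict H10 (Energy.v2 ∘ₗ (waveDomain p).subtype) fun y => y.2.choose_spec.1

/-- `v¹ₓ` as an element of `H¹`, for `y ∈ D(𝒜)`. -/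
def domV1x : waveDomain p →ₗ[ℂ] H1 :=
  LinearMap.codRestrict H1 (weakDeriv₀ ∘ₗ Energy.v1 ∘ₗ (waveDomain p).subtype)
    fun y => y.2.choose_spec.2.1

/-- The flux `u¹ₓ + a u²ₓ` as an element of `H¹`, for `y ∈ D(𝒜)`. -/
def domFlux : waveDomain p →ₗ[ℂ] H1 :=
  LinearMap.codRestrict H1
    (weakDeriv₀ ∘ₗ Energy.u1 ∘ₗ (waveDomain p).subtype + dampMul p ∘ₗ weakDeriv₀ ∘ₗ domU2)
    fun y => y.2.choose_spec.2.2

end components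

/-- The operator `𝒜 (u¹, v¹, u², v²) = (u², v², (u¹ₓ + a u²ₓ)ₓ - v², c v¹ₓₓ + u²)`. -/
def waveOp (p : Params) : Energy p →ₗ.[ℂ] Energy p where
  domain := waveDomain p
  toFun := Energy.ofComponents ∘ₗ LinearMap.prod domU2 (LinearMap.prod domV2 (LinearMap.prod
    (weakDeriv ∘ₗ domFlux - Energy.v2 ∘ₗ (waveDomain p).subtype)
    ((p.c : ℂ) • (weakDeriv ∘ₗ domV1x) + Energy.u2 ∘ₗ (waveDomain p).subtype)))

/-- A `C₀`-semigroup of bounded linear operators on a normed space. -/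
structure C0Semigroup (X : Type*) [NormedAddCommGroup X] [NormedSpace ℂ X] where
  T : ℝ≥0 → X →L[ℂ] X
  map_zero : T 0 = ContinuousLinearMap.id ℂ X
  map_add : ∀ s t, T (s + t) = (T s).comp (T t)
  tendsto_zero : ∀ x, Tendsto (fun t => T t x) (𝓝 0) (𝓝 x)

/-- `A` is the infinitesimal generator of `S`: one has `x ∈ D(A)` and `A x = y` if and only if
`(S(t) x - x) / t → y` as `t → 0⁺`. -/
def C0Semigroup.HasGenerator {X : Type*} [NormedAddCommGroup X] [NormedSpace ℂ X]
    (S : C0Semigroup X) (A : X →ₗ.[ℂ] X) : Prop :=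
  ∀ x y : X, (x, y) ∈ A.graph ↔
    Tendsto (fun t : ℝ≥0 => (t : ℝ)⁻¹ • (S.T t x - x)) (𝓝[>] 0) (𝓝 y)

/-- Exponential stability: `‖S(t)‖ ≤ M e^{-αt}` for all `t ≥ 0`, for some `M, α > 0`. -/
def C0Semigroup.ExpStable {X : Type*} [NormedAddCommGroup X] [NormedSpace ℂ X]
    (S : C0Semigroup X) : Prop :=
  ∃ M > 0, ∃ α > 0, ∀ t : ℝ≥0, ‖S.T t‖ ≤ M * Real.exp (-α * t)

end KVWave

end

/-!
The operator `𝒜` has a bounded inverse `G`, obtained by integrating twice, and `re ⟪𝒜 x, x⟫ ≤ 0`.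
The Yosida approximations `(G - ε)⁻¹` are then bounded and dissipative, and their exponentials
converge strongly, as `ε → 0⁺`, to the semigroup generated by `𝒜`.

Exponential stability bounds the resolvent of `𝒜` on the imaginary axis. Put `l = √c k` with
`k = 2nπ`. The second wave has the undamped mode `e^{ilt} sin (k x) / l`. Combine it with the
displacement `e^{ilt} U` which it forces in the first wave: the residual of this state at `il` is
`l ‖U‖`. On `(-1, 0)` and on `(0, 1)` the function `U` is explicit, up to two amplitudes determined
by the transmission conditions at `0`. Since the damped part of the interval is nearly rigid, the
determinant of these conditions is at least `l` unless `sin l` is of order `l^{-1/2}`. When it is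
that large, `U` is of order `l⁻²` and the residual tends to `0`, which contradicts the resolvent
bound.
-/

noncomputable section

namespace KVWave

/-! ### Generation from a bounded dissipative inverse -/

section Dissipative

variable {H : Type*} [NormedAddCommGroup H] [InnerProductSpace ℂ H]

attribute [local instance] InnerProductSpace.complexToReal

/-- Dissipativity of a bounded operator on a complex inner product space. -/
def IsDissipative (B : H →L[ℂ] H) : Prop :=
  ∀ x, (inner ℂ (B x) x).re ≤ 0

/-- The Yosida approximation `(G - ε)⁻¹` of the possibly unbounded operator `A = G⁻¹`; in terms of
`μ = 1 / ε` this is the usual `μ A (μ - A)⁻¹`. -/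
def yosida (G : H →L[ℂ] H) (ε : ℝ) : H →L[ℂ] H :=
  -resolvent G ε

variable {B C G : H →L[ℂ] H}

theorem isDissipative_zero : IsDissipative (0 : H →L[ℂ] H) := fun x => by
  rw [zero_apply, inner_zero_left, Complex.zero_re]

theorem IsDissipative.real_inner_nonpos (hB : IsDissipative B) (x : H) : inner ℝ (B x) x ≤ 0 :=
  hB x

theorem IsDissipative.mul_norm_sq_le (hG : IsDissipative G) (ε : ℝ) (x : H) :
    ε * ‖x‖ ^ 2 ≤ inner ℝ (ε • x - G x) x := by
  rw [inner_sub_left, real_inner_smul_left, real_inner_self_eq_norm_sq]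
  linarith [hG.real_inner_nonpos x]

theorem IsDissipative.mul_norm_le (hG : IsDissipative G) (ε : ℝ) (x : H) :
    ε * ‖x‖ ≤ ‖ε • x - G x‖ := by
  rcases eq_or_ne x 0 with rfl | hx
  · simp
  · refine le_of_mul_le_mul_right ?_ (norm_pos_iff.2 hx)
    calc ε * ‖x‖ * ‖x‖ = ε * ‖x‖ ^ 2 := by ring
      _ ≤ inner ℝ (ε • x - G x) x := hG.mul_norm_sq_le ε x
      _ ≤ ‖ε • x - G x‖ * ‖x‖ := real_inner_le_norm _ _

theorem IsDissipative.mem_resolventSet [CompleteSpace H] (hG : IsDissipative G) {ε : ℝ}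
    (hε : 0 < ε) : ε ∈ resolventSet ℝ G := by
  rw [spectrum.mem_resolventSet_iff]
  refine ContinuousLinearMap.isUnit_of_forall_le_norm_inner_map _ (c := ⟨ε, hε.le⟩) hε fun x => ?_
  calc ‖x‖ ^ 2 * ε = ε * ‖x‖ ^ 2 := mul_comm _ _
    _ ≤ inner ℝ (ε • x - G x) x := hG.mul_norm_sq_le ε x
    _ ≤ ‖inner ℂ (ε • x - G x) x‖ := Complex.re_le_norm _

theorem IsDissipative.apply_yosida [CompleteSpace H] (hG : IsDissipative G) {ε : ℝ} (hε : 0 < ε)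
    (x : H) : G (yosida G ε x) = x + ε • yosida G ε x := by
  have h := congrArg (fun L : H →L[ℂ] H => L x)
    (Ring.mul_inverse_cancel _ (spectrum.mem_resolventSet_iff.1 (hG.mem_resolventSet hε)))
  change ε • resolvent G ε x - G (resolvent G ε x) = x at h
  rw [yosida, neg_apply, map_neg, smul_neg]
  nth_rewrite 2 [← h]
  abel

theorem IsDissipative.yosida_apply [CompleteSpace H] (hG : IsDissipative G) {ε : ℝ} (hε : 0 < ε)
    (x : H) : yosida G ε (G x) = x + ε • yosida G ε x := by
  have h := congrArg (fun L : H →L[ℂ] H => L x)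
    (Ring.inverse_mul_cancel _ (spectrum.mem_resolventSet_iff.1 (hG.mem_resolventSet hε)))
  change resolvent G ε (ε • x - G x) = x at h
  rw [map_sub, ContinuousLinearMap.map_smul_of_tower] at h
  rw [yosida, neg_apply, neg_apply, smul_neg]
  nth_rewrite 2 [← h]
  abel

theorem commute_yosida (G : H →L[ℂ] H) (ε δ : ℝ) : Commute (yosida G ε) (yosida G δ) := by
  have h : Commute (algebraMap ℝ (H →L[ℂ] H) ε - G) (algebraMap ℝ _ δ - G) :=
    .sub_left (Algebra.commute_algebraMap_left ε _)
      (.sub_right (Algebra.commute_algebraMap_right δ G) (Commute.refl G))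
  exact h.ringInverse_ringInverse.neg_left.neg_right

theorem IsDissipative.isDissipative_yosida [CompleteSpace H] (hG : IsDissipative G) {ε : ℝ}
    (hε : 0 < ε) :
    IsDissipative (yosida G ε) := by
  intro x
  have h := hG.mul_norm_sq_le ε (yosida G ε x)
  have hx : ε • yosida G ε x - G (yosida G ε x) = -x := by
    rw [hG.apply_yosida hε]
    abel
  rw [hx, inner_neg_left, real_inner_comm] at h
  change inner ℝ (yosida G ε x) x ≤ 0
  nlinarith [sq_nonneg ‖yosida G ε x‖]

theorem IsDissipative.mul_norm_yosida_le [CompleteSpace H] (hG : IsDissipative G) {ε : ℝ}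
    (hε : 0 < ε) (x : H) : ε * ‖yosida G ε x‖ ≤ ‖x‖ := by
  have h := hG.mul_norm_le ε (yosida G ε x)
  rwa [hG.apply_yosida hε, sub_add_cancel_right, norm_neg] at h

theorem IsDissipative.norm_yosida_comp_le [CompleteSpace H] (hG : IsDissipative G) {ε : ℝ}
    (hε : 0 < ε) : ‖(yosida G ε).comp G‖ ≤ 2 := by
  refine ContinuousLinearMap.opNorm_le_bound _ zero_le_two fun x => ?_
  rw [ContinuousLinearMap.comp_apply, hG.yosida_apply hε]
  calc ‖x + ε • yosida G ε x‖ ≤ ‖x‖ + ε * ‖yosida G ε x‖ := by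
        simpa only [norm_smul, Real.norm_of_nonneg hε.le] using
          norm_add_le x (ε • yosida G ε x)
    _ ≤ 2 * ‖x‖ := by linarith [hG.mul_norm_yosida_le hε x]

theorem IsDissipative.denseRange [CompleteSpace H] (hG : IsDissipative G)
    (hinj : Function.Injective G) : DenseRange G := by
  have h : (G.range : Submodule ℂ H).topologicalClosure = ⊤ := by
    rw [Submodule.topologicalClosure_eq_top_iff, Submodule.eq_bot_iff]
    intro x hx
    have hGx (y : H) : inner ℝ (G y) x = 0 := congrArg Complex.re (hx _ ⟨y, rfl⟩)
    -- test dissipativity on `x + t • G x` and let `t → 0⁺`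
    have key : ∀ t ∈ Ioi (0 : ℝ), ‖G x‖ ^ 2 + t * inner ℝ (G (G x)) (G x) ≤ 0 := by
      intro t ht
      refine nonpos_of_mul_nonpos_right (a := t) ?_ ht
      calc t * (‖G x‖ ^ 2 + t * inner ℝ (G (G x)) (G x))
          = inner ℝ (G (x + t • G x)) (x + t • G x) := by
            rw [inner_add_right, hGx, real_inner_smul_right, map_add,
              ContinuousLinearMap.map_smul_of_tower, inner_add_left, real_inner_smul_left,
              real_inner_self_eq_norm_sq, zero_add]
        _ ≤ 0 := hG.real_inner_nonpos _
    have hlim : Tendsto (fun t : ℝ => ‖G x‖ ^ 2 + t * inner ℝ (G (G x)) (G x)) (𝓝[>] 0)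
        (𝓝 (‖G x‖ ^ 2 + 0 * inner ℝ (G (G x)) (G x))) :=
      (Continuous.tendsto (by fun_prop) 0).mono_left nhdsWithin_le_nhds
    have hle := le_of_tendsto hlim (eventually_nhdsWithin_of_forall key)
    rw [zero_mul, add_zero] at hle
    refine hinj ?_
    rw [map_zero, ← norm_eq_zero]
    exact pow_eq_zero_iff two_ne_zero |>.1 (le_antisymm hle (sq_nonneg _))
  rw [DenseRange, dense_iff_closure_eq]
  exact congrArg (fun K : Submodule ℂ H => (K : Set H)) h

variable [CompleteSpace H]

theorem hasDerivAt_exp_smul_apply (B : H →L[ℂ] H) (x : H) (t : ℝ) :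
    HasDerivAt (fun s : ℝ => NormedSpace.exp (s • B) x) (NormedSpace.exp (t • B) (B x)) t :=
  ((ContinuousLinearMap.apply ℂ H x).restrictScalars ℝ).hasFDerivAt.comp_hasDerivAt t
    (hasDerivAt_exp_smul_const (𝕂 := ℝ) B t)

theorem exp_smul_apply_comm (h : Commute B C) (t : ℝ) (x : H) :
    NormedSpace.exp (t • B) (C x) = C (NormedSpace.exp (t • B) x) :=
  congrArg (fun L : H →L[ℂ] H => L x) ((h.smul_left t).exp_left (𝔸 := H →L[ℂ] H)).eq

theorem exp_add_smul_apply (B : H →L[ℂ] H) (s t : ℝ) (x : H) :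
    NormedSpace.exp ((s + t) • B) x = NormedSpace.exp (s • B) (NormedSpace.exp (t • B) x) := by
  let _ : NormedAlgebra ℚ (H →L[ℂ] H) := NormedAlgebra.restrictScalars ℚ ℂ _
  rw [add_smul, NormedSpace.exp_add_of_commute (((Commute.refl B).smul_left s).smul_right t)]
  rfl

theorem IsDissipative.norm_exp_smul_apply_le (hB : IsDissipative B) {t : ℝ} (ht : 0 ≤ t) (x : H) :
    ‖NormedSpace.exp (t • B) x‖ ≤ ‖x‖ := by
  have hderiv (s : ℝ) := (hasDerivAt_exp_smul_apply B x s).norm_sq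
  have hanti : Antitone fun s : ℝ => ‖NormedSpace.exp (s • B) x‖ ^ 2 := by
    refine antitone_of_deriv_nonpos (fun s => (hderiv s).differentiableAt) fun s => ?_
    rw [(hderiv s).deriv, exp_smul_apply_comm (Commute.refl B), real_inner_comm]
    linarith [hB.real_inner_nonpos (NormedSpace.exp (s • B) x)]
  have h := hanti ht
  simp only [zero_smul, NormedSpace.exp_zero, one_apply_eq_self] at h
  exact (pow_le_pow_iff_left₀ (norm_nonneg _) (norm_nonneg _) two_ne_zero).1 h

theorem IsDissipative.norm_exp_smul_le (hB : IsDissipative B) {t : ℝ} (ht : 0 ≤ t) :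
    ‖NormedSpace.exp (t • B)‖ ≤ 1 :=
  ContinuousLinearMap.opNorm_le_bound _ zero_le_one fun x => by
    rw [one_mul]
    exact hB.norm_exp_smul_apply_le ht x

theorem IsDissipative.norm_exp_smul_sub_exp_smul_le (hBC : Commute B C) (hB : IsDissipative B)
    (hC : IsDissipative C) {t : ℝ} (ht : 0 ≤ t) (x : H) :
    ‖NormedSpace.exp (t • B) x - NormedSpace.exp (t • C) x‖ ≤ t * ‖B x - C x‖ := by
  -- interpolate by `s ↦ exp (s B) exp ((t - s) C) x`
  have hderiv (s : ℝ) : HasDerivAt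
      (fun s : ℝ => NormedSpace.exp (s • B) (NormedSpace.exp ((t - s) • C) x))
      (NormedSpace.exp (s • B) (NormedSpace.exp ((t - s) • C) (B x - C x))) s := by
    have hexpB : HasDerivAt (fun s : ℝ => (NormedSpace.exp (s • B)).restrictScalars ℝ)
        ((NormedSpace.exp (s • B) * B).restrictScalars ℝ) s :=
      (ContinuousLinearMap.restrictScalarsL ℂ H H ℝ ℝ).hasFDerivAt.comp_hasDerivAt s
        (hasDerivAt_exp_smul_const (𝕂 := ℝ) B s)
    have hexpC : HasDerivAt (fun s : ℝ => NormedSpace.exp ((t - s) • C) x)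
        ((-1 : ℝ) • NormedSpace.exp ((t - s) • C) (C x)) s :=
      (hasDerivAt_exp_smul_apply C x (t - s)).scomp s ((hasDerivAt_id s).const_sub t)
    refine (hexpB.clm_apply hexpC).congr_deriv ?_
    change NormedSpace.exp (s • B) (B (NormedSpace.exp ((t - s) • C) x)) +
      NormedSpace.exp (s • B) ((-1 : ℝ) • NormedSpace.exp ((t - s) • C) (C x)) = _
    rw [neg_one_smul, map_neg, map_sub, map_sub, exp_smul_apply_comm hBC.symm, ← sub_eq_add_neg]
  have h := norm_image_sub_le_of_norm_deriv_le_segment' (a := 0) (b := t) (C := ‖B x - C x‖)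
    (fun s _ => (hderiv s).hasDerivWithinAt) (fun s hs =>
      (hB.norm_exp_smul_apply_le hs.1 _).trans
        (hC.norm_exp_smul_apply_le (sub_nonneg.2 hs.2.le) _))
    t ⟨ht, le_rfl⟩
  simpa only [sub_self, sub_zero, zero_smul, NormedSpace.exp_zero, one_apply_eq_self,
    mul_comm] using h

theorem IsDissipative.norm_exp_smul_sub_le (hB : IsDissipative B) {t : ℝ} (ht : 0 ≤ t) (x : H) :
    ‖NormedSpace.exp (t • B) x - x‖ ≤ t * ‖B x‖ := by
  simpa only [smul_zero, NormedSpace.exp_zero, one_apply_eq_self, zero_apply, sub_zero] using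
    hB.norm_exp_smul_sub_exp_smul_le (Commute.zero_right B) isDissipative_zero ht x

theorem IsDissipative.norm_exp_smul_sub_sub_le (hB : IsDissipative B) {t : ℝ} (ht : 0 ≤ t)
    (x : H) : ‖NormedSpace.exp (t • B) x - x - t • B x‖ ≤ t * (t * ‖B (B x)‖) := by
  have hderiv (s : ℝ) : HasDerivAt (fun s : ℝ => NormedSpace.exp (s • B) x - s • B x)
      (NormedSpace.exp (s • B) (B x) - (1 : ℝ) • B x) s :=
    (hasDerivAt_exp_smul_apply B x s).sub ((hasDerivAt_id s).smul_const (B x))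
  have h := norm_image_sub_le_of_norm_deriv_le_segment' (a := 0) (b := t)
    (C := t * ‖B (B x)‖) (fun s _ => (hderiv s).hasDerivWithinAt) (fun s hs => by
      rw [one_smul]
      exact (hB.norm_exp_smul_sub_le hs.1 (B x)).trans
        (mul_le_mul_of_nonneg_right hs.2.le (norm_nonneg _))) t ⟨ht, le_rfl⟩
  simp only [zero_smul, NormedSpace.exp_zero, one_apply_eq_self, sub_zero] at h
  rwa [mul_comm, sub_right_comm]

end Dissipative

section StrongLimits

variable {ι 𝕜 E F : Type*} [NontriviallyNormedField 𝕜] [NormedAddCommGroup E] [NormedSpace 𝕜 E]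
  [NormedAddCommGroup F] [NormedSpace 𝕜 F] {l : Filter ι} {T : ι → E →L[𝕜] F} {M : ℝ}

theorem tendsto_apply_of_norm_le (hT : ∀ᶠ i in l, ‖T i‖ ≤ M) {x : E} {y : F}
    (hx : Tendsto (fun i => T i x) l (𝓝 y)) {u : ι → E} (hu : Tendsto u l (𝓝 x)) :
    Tendsto (fun i => T i (u i)) l (𝓝 y) := by
  have hdiff : Tendsto (fun i => T i (u i - x)) l (𝓝 0) := by
    have hlim := (tendsto_iff_norm_sub_tendsto_zero.1 hu).const_mul M
    rw [mul_zero] at hlim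
    refine squeeze_zero_norm' (hT.mono fun i hi => ?_) hlim
    exact (T i).le_of_opNorm_le hi _
  simpa only [map_sub, sub_add_cancel, zero_add] using hdiff.add hx

theorem tendsto_apply_of_denseRange (hT : ∀ᶠ i in l, ‖T i‖ ≤ M) {L : E →L[𝕜] F} {α : Type*}
    {g : α → E} (hg : DenseRange g) (h : ∀ a, Tendsto (fun i => T i (g a)) l (𝓝 (L (g a))))
    (x : E) : Tendsto (fun i => T i x) l (𝓝 (L x)) := by
  rw [Metric.tendsto_nhds]
  intro η hη
  set K := max M 0 + ‖L‖ + 1 with hK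
  have hK0 : 0 < K := by positivity
  obtain ⟨a, ha⟩ := Metric.denseRange_iff.1 hg x (η / 2 / K) (by positivity)
  rw [dist_eq_norm, lt_div_iff₀ hK0] at ha
  filter_upwards [hT, Metric.tendsto_nhds.1 (h a) (η / 2) (by positivity)] with i hi hia
  rw [dist_eq_norm] at hia ⊢
  calc ‖T i x - L x‖ = ‖T i (x - g a) + (T i (g a) - L (g a)) - L (x - g a)‖ := by
        rw [map_sub, map_sub]
        abel_nf
    _ ≤ ‖T i (x - g a)‖ + ‖T i (g a) - L (g a)‖ + ‖L (x - g a)‖ :=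
        (norm_sub_le _ _).trans (add_le_add_left (norm_add_le _ _) _)
    _ ≤ max M 0 * ‖x - g a‖ + ‖T i (g a) - L (g a)‖ + ‖L‖ * ‖x - g a‖ := by
        gcongr
        · exact (T i).le_of_opNorm_le (hi.trans (le_max_left _ _)) _
        · exact L.le_opNorm _
    _ ≤ ‖x - g a‖ * K + ‖T i (g a) - L (g a)‖ := by
        rw [hK]
        linarith [norm_nonneg (x - g a)]
    _ < η := by linarith

end StrongLimits

section Generation

variable {H : Type*} [NormedAddCommGroup H] [InnerProductSpace ℂ H]

attribute [local instance] InnerProductSpace.complexToReal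

theorem C0Semigroup.eq_zero_of_tendsto_self {S : C0Semigroup H} (hS : ∀ t, ‖S.T t‖ ≤ 1) {u : H}
    (hu : Tendsto (fun t : ℝ≥0 => (t : ℝ)⁻¹ • (S.T t u - u)) (𝓝[>] 0) (𝓝 u)) : u = 0 := by
  have hle (t : ℝ≥0) : inner ℝ ((t : ℝ)⁻¹ • (S.T t u - u)) u ≤ 0 := by
    have hcontr : inner ℝ (S.T t u) u ≤ inner ℝ u u :=
      calc inner ℝ (S.T t u) u ≤ ‖S.T t u‖ * ‖u‖ := real_inner_le_norm _ _
        _ ≤ ‖u‖ * ‖u‖ := by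
          gcongr
          simpa only [one_mul] using (S.T t).le_of_opNorm_le (hS t) u
        _ = inner ℝ u u := (real_inner_self_eq_norm_mul_norm u).symm
    rw [real_inner_smul_left, inner_sub_left]
    exact mul_nonpos_of_nonneg_of_nonpos (inv_nonneg.2 t.2) (sub_nonpos.2 hcontr)
  exact real_inner_self_nonpos.1
    (le_of_tendsto (hu.inner tendsto_const_nhds) (Eventually.of_forall hle))

variable [CompleteSpace H] {G : H →L[ℂ] H}

theorem IsDissipative.tendsto_yosida_apply (hG : IsDissipative G) (hinj : Function.Injective G)
    (x : H) : Tendsto (fun ε => yosida G ε (G x)) (𝓝[>] 0) (𝓝 x) := by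
  refine tendsto_apply_of_denseRange (T := fun ε => (yosida G ε).comp G)
    (L := ContinuousLinearMap.id ℂ H) (eventually_nhdsWithin_of_forall fun ε hε =>
      hG.norm_yosida_comp_le hε) (hG.denseRange hinj) (fun z => ?_) x
  rw [tendsto_iff_norm_sub_tendsto_zero]
  have hlim : Tendsto (fun ε : ℝ => ε * (2 * ‖z‖)) (𝓝[>] 0) (𝓝 0) := by
    have h : Tendsto (fun ε : ℝ => ε * (2 * ‖z‖)) (𝓝 0) (𝓝 (0 * (2 * ‖z‖))) :=
      Continuous.tendsto (by fun_prop) 0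
    rw [zero_mul] at h
    exact h.mono_left nhdsWithin_le_nhds
  refine squeeze_zero' (Eventually.of_forall fun _ => norm_nonneg _)
    (eventually_nhdsWithin_of_forall fun ε (hε : 0 < ε) => ?_) hlim
  rw [ContinuousLinearMap.comp_apply, hG.yosida_apply hε, ContinuousLinearMap.id_apply,
    add_sub_cancel_left, norm_smul, Real.norm_of_nonneg hε.le]
  gcongr
  exact ((yosida G ε).comp G).le_of_opNorm_le (hG.norm_yosida_comp_le hε) z

theorem IsDissipative.exists_tendsto_exp_yosida_apply (hG : IsDissipative G)
    (hinj : Function.Injective G) {t : ℝ} (ht : 0 ≤ t) (x : H) :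
    ∃ y, Tendsto (fun ε => NormedSpace.exp (t • yosida G ε) x) (𝓝[>] 0) (𝓝 y) := by
  rw [← cauchy_map_iff_exists_tendsto, cauchy_map_iff', uniformity_eq_comap_nhds_zero,
    tendsto_comap_iff]
  have hpos : ∀ᶠ q : ℝ × ℝ in 𝓝[>] 0 ×ˢ 𝓝[>] 0, 0 < q.1 ∧ 0 < q.2 :=
    prod_mem_prod self_mem_nhdsWithin self_mem_nhdsWithin
  refine tendsto_apply_of_denseRange (M := 1 + 1) (L := 0) (T := fun q : ℝ × ℝ =>
    NormedSpace.exp (t • yosida G q.2) - NormedSpace.exp (t • yosida G q.1))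
    (hpos.mono fun q hq => (norm_sub_le _ _).trans (add_le_add
      ((hG.isDissipative_yosida hq.2).norm_exp_smul_le ht)
      ((hG.isDissipative_yosida hq.1).norm_exp_smul_le ht))) (hG.denseRange hinj) (fun z => ?_) x
  have hlim : Tendsto (fun q : ℝ × ℝ => t * ‖yosida G q.2 (G z) - yosida G q.1 (G z)‖)
      (𝓝[>] 0 ×ˢ 𝓝[>] 0) (𝓝 0) := by
    have h := hG.tendsto_yosida_apply hinj z
    simpa only [sub_self, norm_zero, mul_zero, Function.comp_apply] using
      (((h.comp tendsto_snd).sub (h.comp tendsto_fst)).norm.const_mul t)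
  exact squeeze_zero_norm' (hpos.mono fun q hq =>
    (hG.isDissipative_yosida hq.2).norm_exp_smul_sub_exp_smul_le (commute_yosida G _ _)
      (hG.isDissipative_yosida hq.1) ht (G z)) hlim

theorem IsDissipative.exists_tendsto_exp_yosida (hG : IsDissipative G)
    (hinj : Function.Injective G) : ∃ T : ℝ≥0 → H →L[ℂ] H, ∀ (t : ℝ≥0) (x : H),
      Tendsto (fun ε => NormedSpace.exp ((t : ℝ) • yosida G ε) x) (𝓝[>] 0) (𝓝 (T t x)) := by
  choose L hL using fun (t : ℝ≥0) => hG.exists_tendsto_exp_yosida_apply hinj t.2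
  exact ⟨fun t => continuousLinearMapOfTendsto _ (tendsto_pi_nhds.2 (hL t)), hL⟩

section Limit

variable {T : ℝ≥0 → H →L[ℂ] H} (hT : ∀ (t : ℝ≥0) (x : H),
  Tendsto (fun ε => NormedSpace.exp ((t : ℝ) • yosida G ε) x) (𝓝[>] 0) (𝓝 (T t x)))
include hT

theorem IsDissipative.norm_le_one_of_tendsto (hG : IsDissipative G) (t : ℝ≥0) : ‖T t‖ ≤ 1 := by
  refine ContinuousLinearMap.opNorm_le_bound _ zero_le_one fun x => ?_
  rw [one_mul]
  exact le_of_tendsto (hT t x).norm (eventually_nhdsWithin_of_forall fun ε hε =>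
    (hG.isDissipative_yosida hε).norm_exp_smul_apply_le t.2 x)

theorem map_zero_of_tendsto : T 0 = ContinuousLinearMap.id ℂ H := by
  ext x
  refine tendsto_nhds_unique (hT 0 x) ?_
  simp only [NNReal.coe_zero, zero_smul, NormedSpace.exp_zero, one_apply_eq_self,
    ContinuousLinearMap.id_apply, tendsto_const_nhds]

theorem IsDissipative.map_add_of_tendsto (hG : IsDissipative G) (s t : ℝ≥0) :
    T (s + t) = (T s).comp (T t) := by
  ext x
  refine tendsto_nhds_unique (hT (s + t) x) ?_
  simp only [NNReal.coe_add, exp_add_smul_apply]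
  exact tendsto_apply_of_norm_le (eventually_nhdsWithin_of_forall fun ε hε =>
    (hG.isDissipative_yosida hε).norm_exp_smul_le s.2) (hT s (T t x)) (hT t x)

theorem IsDissipative.norm_sub_le_of_tendsto (hG : IsDissipative G) (hinj : Function.Injective G)
    (t : ℝ≥0) (x : H) : ‖T t (G x) - G x‖ ≤ t * ‖x‖ :=
  le_of_tendsto_of_tendsto ((hT t (G x)).sub_const (G x)).norm
    ((hG.tendsto_yosida_apply hinj x).norm.const_mul _)
    (eventually_nhdsWithin_of_forall fun _ hε =>
      (hG.isDissipative_yosida hε).norm_exp_smul_sub_le t.2 (G x))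

theorem IsDissipative.norm_sub_sub_le_of_tendsto (hG : IsDissipative G)
    (hinj : Function.Injective G) (t : ℝ≥0) (x : H) :
    ‖T t (G (G x)) - G (G x) - (t : ℝ) • G x‖ ≤ t * (t * ‖x‖) := by
  have hyosida := hG.tendsto_yosida_apply hinj
  have hsq : Tendsto (fun ε => yosida G ε (yosida G ε (G (G x)))) (𝓝[>] 0) (𝓝 x) := by
    have h := tendsto_apply_of_norm_le (T := fun ε => (yosida G ε).comp G)
      (eventually_nhdsWithin_of_forall fun ε hε => hG.norm_yosida_comp_le hε) (hyosida x)
      (hyosida x)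
    refine h.congr' (eventually_nhdsWithin_of_forall fun ε hε => ?_)
    rw [ContinuousLinearMap.comp_apply, hG.apply_yosida hε, ← hG.yosida_apply hε]
  exact le_of_tendsto_of_tendsto
    (((hT t (G (G x))).sub_const (G (G x))).sub ((hyosida (G x)).const_smul (t : ℝ))).norm
    ((hsq.norm.const_mul _).const_mul _) (eventually_nhdsWithin_of_forall fun _ hε =>
      (hG.isDissipative_yosida hε).norm_exp_smul_sub_sub_le t.2 (G (G x)))

theorem IsDissipative.tendsto_zero_of_tendsto (hG : IsDissipative G)
    (hinj : Function.Injective G) (x : H) : Tendsto (fun t => T t x) (𝓝 0) (𝓝 x) := by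
  refine tendsto_apply_of_denseRange (L := ContinuousLinearMap.id ℂ H)
    (Eventually.of_forall (hG.norm_le_one_of_tendsto hT)) (hG.denseRange hinj) (fun z => ?_) x
  rw [ContinuousLinearMap.id_apply, tendsto_iff_norm_sub_tendsto_zero]
  have hlim : Tendsto (fun t : ℝ≥0 => t * ‖z‖) (𝓝 0) (𝓝 ((0 : ℝ≥0) * ‖z‖)) :=
    Continuous.tendsto (by fun_prop) 0
  rw [NNReal.coe_zero, zero_mul] at hlim
  exact squeeze_zero (fun _ => norm_nonneg _)
    (fun t => hG.norm_sub_le_of_tendsto hT hinj t z) hlim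

theorem IsDissipative.tendsto_slope_of_tendsto (hG : IsDissipative G)
    (hinj : Function.Injective G) (x : H) :
    Tendsto (fun t : ℝ≥0 => (t : ℝ)⁻¹ • (T t (G x) - G x)) (𝓝[>] 0) (𝓝 x) := by
  refine tendsto_apply_of_denseRange (M := 1) (L := ContinuousLinearMap.id ℂ H)
    (T := fun t : ℝ≥0 => (t : ℝ)⁻¹ • (T t - ContinuousLinearMap.id ℂ H).comp G)
    (eventually_nhdsWithin_of_forall fun t (ht : 0 < t) => ?_) (hG.denseRange hinj) (fun z => ?_) x
  · refine ContinuousLinearMap.opNorm_le_bound _ zero_le_one fun z => ?_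
    change ‖(t : ℝ)⁻¹ • (T t (G z) - G z)‖ ≤ _
    rw [norm_smul, norm_inv, Real.norm_of_nonneg t.coe_nonneg, one_mul,
      inv_mul_le_iff₀ (NNReal.coe_pos.2 ht)]
    exact hG.norm_sub_le_of_tendsto hT hinj t z
  · rw [ContinuousLinearMap.id_apply, tendsto_iff_norm_sub_tendsto_zero]
    have hlim : Tendsto (fun t : ℝ≥0 => t * ‖z‖) (𝓝 0) (𝓝 ((0 : ℝ≥0) * ‖z‖)) :=
      Continuous.tendsto (by fun_prop) 0
    rw [NNReal.coe_zero, zero_mul] at hlim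
    refine squeeze_zero' (Eventually.of_forall fun _ => norm_nonneg _)
      (eventually_nhdsWithin_of_forall fun t (ht : 0 < t) => ?_)
      (hlim.mono_left nhdsWithin_le_nhds)
    have ht' : (0 : ℝ) < t := ht
    change ‖(t : ℝ)⁻¹ • (T t (G (G z)) - G (G z)) - G z‖ ≤ t * ‖z‖
    rw [← inv_smul_smul₀ ht'.ne' (G z), ← smul_sub, inv_smul_smul₀ ht'.ne', norm_smul, norm_inv,
      Real.norm_of_nonneg t.coe_nonneg, inv_mul_le_iff₀ ht']
    exact hG.norm_sub_sub_le_of_tendsto hT hinj t z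

end Limit

theorem IsDissipative.exists_semigroup (hG : IsDissipative G) (hinj : Function.Injective G) :
    ∃ S : C0Semigroup H, (∀ t, ‖S.T t‖ ≤ 1) ∧ ∀ x,
      Tendsto (fun t : ℝ≥0 => (t : ℝ)⁻¹ • (S.T t (G x) - G x)) (𝓝[>] 0) (𝓝 x) := by
  obtain ⟨T, hT⟩ := hG.exists_tendsto_exp_yosida hinj
  exact ⟨⟨T, map_zero_of_tendsto hT, hG.map_add_of_tendsto hT, hG.tendsto_zero_of_tendsto hT hinj⟩,
    hG.norm_le_one_of_tendsto hT, hG.tendsto_slope_of_tendsto hT hinj⟩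

theorem IsDissipative.exists_hasGenerator (hG : IsDissipative G) {A : H →ₗ.[ℂ] H}
    (hA : ∀ x y, (x, y) ∈ A.graph ↔ x = G y) : ∃ S : C0Semigroup H, S.HasGenerator A := by
  have hinj : Function.Injective G := (injective_iff_map_eq_zero G).2 fun y hy =>
    A.graph_fst_eq_zero_snd ((hA 0 y).2 hy.symm) rfl
  obtain ⟨S, hS1, hS⟩ := hG.exists_semigroup hinj
  refine ⟨S, fun x y => ⟨fun h => ?_, fun h => ?_⟩⟩
  · rw [(hA x y).1 h]
    exact hS y
  · -- with `(1 - A) (G w) = x - y`, the difference `x - G w` is fixed by the derivative of `S`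
    obtain ⟨w, hw⟩ : ∃ w, x - G w = y - w := by
      refine ⟨yosida G 1 (x - y), ?_⟩
      rw [hG.apply_yosida one_pos, one_smul]
      abel
    have hfix : Tendsto (fun t : ℝ≥0 => (t : ℝ)⁻¹ • (S.T t (x - G w) - (x - G w))) (𝓝[>] 0)
        (𝓝 (x - G w)) := by
      have hdiff := Tendsto.sub h (hS w)
      rw [← hw] at hdiff
      refine hdiff.congr fun t => ?_
      rw [← smul_sub, map_sub]
      congr 1
      abel
    have hzero := S.eq_zero_of_tendsto_self hS1 hfix
    rw [hA, sub_eq_zero.1 hzero, sub_eq_zero.1 (hw.symm.trans hzero)]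

end Generation

/-! ### The resolvent of an exponentially stable semigroup -/

section Stability

variable {X : Type*} [NormedAddCommGroup X] [NormedSpace ℂ X] {S : C0Semigroup X}

theorem C0Semigroup.norm_apply_sub_apply_le (S : C0Semigroup X) (s t : ℝ≥0) (x : X) :
    ‖S.T s x - S.T t x‖ ≤ ‖S.T (min s t)‖ * ‖S.T (nndist s t) x - x‖ := by
  wlog hst : t ≤ s generalizing s t
  · rw [norm_sub_rev, min_comm, nndist_comm]
    exact this t s (le_of_not_ge hst)
  have hs : s = t + nndist s t := by
    rw [NNReal.nndist_eq, tsub_eq_zero_of_le hst, max_eq_left zero_le,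
      add_tsub_cancel_of_le hst]
  rw [min_eq_right hst]
  conv_lhs => rw [hs, S.map_add, ContinuousLinearMap.comp_apply, ← map_sub]
  exact (S.T t).le_opNorm _

theorem C0Semigroup.continuous_apply {g : ℝ≥0 → ℝ} (hg : Continuous g)
    (hS : ∀ t, ‖S.T t‖ ≤ g t) (x : X) : Continuous fun t => S.T t x := by
  refine continuous_iff_continuousAt.2 fun t => tendsto_iff_norm_sub_tendsto_zero.2 ?_
  have hdist : Tendsto (fun s : ℝ≥0 => nndist s t) (𝓝 t) (𝓝 0) := by
    have h : Continuous fun s : ℝ≥0 => nndist s t := by fun_prop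
    simpa only [nndist_self] using h.tendsto t
  have hmin : Tendsto (fun s => g (min s t)) (𝓝 t) (𝓝 (g (min t t))) :=
    (hg.comp (continuous_id.min continuous_const)).tendsto t
  have hlim := hmin.mul (tendsto_iff_norm_sub_tendsto_zero.1 ((S.tendsto_zero x).comp hdist))
  rw [mul_zero] at hlim
  exact squeeze_zero (fun _ => norm_nonneg _) (fun s => (S.norm_apply_sub_apply_le s t x).trans
    (mul_le_mul_of_nonneg_right (hS _) (norm_nonneg _))) hlim

variable {A : X →ₗ.[ℂ] X} {x y : X}

theorem C0Semigroup.HasGenerator.hasDerivWithinAt (hA : S.HasGenerator A)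
    (hxy : (x, y) ∈ A.graph) {t : ℝ} (ht : 0 ≤ t) :
    HasDerivWithinAt (fun s : ℝ => S.T s.toNNReal x) (S.T t.toNNReal y) (Ici t) t := by
  rw [← hasDerivWithinAt_Ioi_iff_Ici, hasDerivWithinAt_iff_tendsto_slope' self_notMem_Ioi]
  have hshift : Tendsto (fun s : ℝ => (s - t).toNNReal) (𝓝[>] t) (𝓝[>] 0) := by
    refine tendsto_nhdsWithin_of_tendsto_nhds_of_eventually_within _ ?_ ?_
    · have h : Continuous fun s : ℝ => (s - t).toNNReal := by fun_prop
      simpa only [sub_self, Real.toNNReal_zero] using (h.tendsto t).mono_left nhdsWithin_le_nhds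
    · filter_upwards [self_mem_nhdsWithin] with s hs
      exact Real.toNNReal_pos.2 (sub_pos.2 hs)
  refine (((S.T t.toNNReal).continuous.tendsto y).comp (((hA x y).1 hxy).comp hshift)).congr' ?_
  filter_upwards [self_mem_nhdsWithin] with s hs
  have hst : 0 ≤ s - t := sub_nonneg.2 (le_of_lt hs)
  have hs_eq : s.toNNReal = t.toNNReal + (s - t).toNNReal := by
    rw [← Real.toNNReal_add ht hst, add_sub_cancel]
  simp only [Function.comp_apply]
  rw [slope_def_module, hs_eq, S.map_add, Real.coe_toNNReal _ hst,
    ContinuousLinearMap.comp_apply, ← map_sub, ContinuousLinearMap.map_smul_of_tower]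

variable {M α : ℝ} {z : ℂ}

theorem C0Semigroup.HasGenerator.hasDerivWithinAt_exp_smul (hA : S.HasGenerator A)
    (hxy : (x, y) ∈ A.graph) {t : ℝ} (ht : 0 ≤ t) :
    HasDerivWithinAt (fun s : ℝ => Complex.exp (-z * s) • S.T s.toNNReal x)
      (Complex.exp (-z * t) • S.T t.toNNReal (y - z • x)) (Ici t) t := by
  have hexp : HasDerivAt (fun s : ℝ => Complex.exp (-z * s)) (Complex.exp (-z * t) * -z) t := by
    simpa only [Complex.ofRealCLM_apply, Complex.ofReal_one, mul_one] using
      ((Complex.ofRealCLM.hasDerivAt (x := t)).const_mul (-z)).cexp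
  refine (hexp.hasDerivWithinAt.smul (hA.hasDerivWithinAt hxy ht)).congr_deriv ?_
  rw [map_sub, map_smul]
  module

theorem C0Semigroup.norm_exp_smul_apply_le
    (hS : ∀ t, ‖S.T t‖ ≤ M * Real.exp (-α * t)) {t : ℝ} (ht : 0 ≤ t) (x : X) :
    ‖Complex.exp (-z * t) • S.T t.toNNReal x‖ ≤ M * Real.exp (-(α + z.re) * t) * ‖x‖ := by
  have hTt : ‖S.T t.toNNReal‖ ≤ M * Real.exp (-α * t) := by
    simpa only [Real.coe_toNNReal _ ht] using hS t.toNNReal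
  have hexp : ‖Complex.exp (-z * t)‖ = Real.exp (-z.re * t) := by
    rw [Complex.norm_exp, Complex.re_mul_ofReal, Complex.neg_re]
  rw [norm_smul, hexp]
  calc Real.exp (-z.re * t) * ‖S.T t.toNNReal x‖
      ≤ Real.exp (-z.re * t) * (M * Real.exp (-α * t) * ‖x‖) := by
        gcongr
        exact (S.T _).le_of_opNorm_le hTt x
    _ = M * Real.exp (-(α + z.re) * t) * ‖x‖ := by
        rw [neg_add, add_mul, Real.exp_add]
        ring

theorem C0Semigroup.HasGenerator.norm_exp_smul_apply_sub_le (hA : S.HasGenerator A)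
    (hS : ∀ t, ‖S.T t‖ ≤ M * Real.exp (-α * t)) (hz : 0 < α + z.re)
    (hxy : (x, y) ∈ A.graph) {t : ℝ} (ht : 0 ≤ t) :
    ‖Complex.exp (-z * t) • S.T t.toNNReal x - x‖ ≤
      M / (α + z.re) * ‖y - z • x‖ * (1 - Real.exp (-(α + z.re) * t)) := by
  have hcont : Continuous fun s : ℝ => Complex.exp (-z * s) • S.T s.toNNReal x - x := by
    have hT : Continuous fun t => S.T t x :=
      S.continuous_apply (g := fun t => M * Real.exp (-α * t)) (by fun_prop) hS x
    fun_prop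
  have hprim (s : ℝ) : HasDerivAt
      (fun s => M / (α + z.re) * ‖y - z • x‖ * (1 - Real.exp (-(α + z.re) * s)))
      (M * Real.exp (-(α + z.re) * s) * ‖y - z • x‖) s := by
    refine ((((hasDerivAt_id s).const_mul (-(α + z.re))).exp.const_sub 1).const_mul
      (M / (α + z.re) * ‖y - z • x‖)).congr_deriv ?_
    simp only [id]
    field_simp
  refine image_norm_le_of_norm_deriv_right_le_deriv_boundary hcont.continuousOn
    (fun s hs => (hA.hasDerivWithinAt_exp_smul hxy hs.1).sub_const x) ?_ hprim
    (fun s hs => S.norm_exp_smul_apply_le hS hs.1 _) ⟨ht, le_rfl⟩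
  simp [S.map_zero]

theorem C0Semigroup.HasGenerator.norm_le_div_mul_norm_sub_smul (hA : S.HasGenerator A)
    (hS : ∀ t, ‖S.T t‖ ≤ M * Real.exp (-α * t)) (hz : 0 < α + z.re)
    (hxy : (x, y) ∈ A.graph) : ‖x‖ ≤ M / (α + z.re) * ‖y - z • x‖ := by
  have hexp : Tendsto (fun t : ℝ => Real.exp (-(α + z.re) * t)) atTop (𝓝 0) :=
    Real.tendsto_exp_atBot.comp (tendsto_id.const_mul_atTop_of_neg (neg_lt_zero.2 hz))
  have hlim : Tendsto (fun t : ℝ => M / (α + z.re) * ‖y - z • x‖ *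
      (1 - Real.exp (-(α + z.re) * t)) + M * Real.exp (-(α + z.re) * t) * ‖x‖) atTop
      (𝓝 (M / (α + z.re) * ‖y - z • x‖)) := by
    simpa only [sub_zero, mul_one, mul_zero, zero_mul, add_zero] using
      ((hexp.const_sub 1).const_mul (M / (α + z.re) * ‖y - z • x‖)).add
        ((hexp.const_mul M).mul_const ‖x‖)
  refine ge_of_tendsto hlim ?_
  filter_upwards [eventually_ge_atTop 0] with t ht
  calc ‖x‖ ≤ ‖Complex.exp (-z * t) • S.T t.toNNReal x - x‖ +
        ‖Complex.exp (-z * t) • S.T t.toNNReal x‖ := by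
        rw [norm_sub_rev]
        exact norm_le_norm_sub_add _ _
    _ ≤ _ := add_le_add (hA.norm_exp_smul_apply_sub_le hS hz hxy ht)
        (S.norm_exp_smul_apply_le hS ht x)

theorem C0Semigroup.ExpStable.exists_norm_le (hS : S.ExpStable) (hA : S.HasGenerator A) :
    ∃ K : ℝ, 0 ≤ K ∧ ∀ x y : X, (x, y) ∈ A.graph →
      ∀ l : ℝ, ‖x‖ ≤ K * ‖y - (Complex.I * l) • x‖ := by
  obtain ⟨M, hM, α, hα, hS⟩ := hS
  refine ⟨M / α, by positivity, fun x y hxy l => ?_⟩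
  have hre : (Complex.I * l).re = 0 := by simp
  simpa only [hre, add_zero] using
    hA.norm_le_div_mul_norm_sub_smul (z := Complex.I * l) hS (by rwa [hre, add_zero]) hxy

end Stability

/-! ### Weak derivatives and primitives on `(-1, 1)` -/

section Piecewise

/-- The function which is `f` on the negative half line and `g` on the nonnegative one: solutions
of transmission problems at the interface `0` of the damped region have this form. -/
def glue (f g : ℝ → ℂ) (x : ℝ) : ℂ := if 0 ≤ x then g x else f x

variable {f g f' g' : ℝ → ℂ} {x : ℝ}

theorem glue_self (f : ℝ → ℂ) : glue f f = f := funext fun _ => ite_self _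

theorem glue_of_nonneg (hx : 0 ≤ x) : glue f g x = g x := if_pos hx

theorem glue_of_neg (hx : x < 0) : glue f g x = f x := if_neg (not_le.2 hx)

theorem continuous_glue (hf : Continuous f) (hg : Continuous g) (h : f 0 = g 0) :
    Continuous (glue f g) :=
  hg.if_le hf continuous_const continuous_id fun x hx => by rw [← hx, h]

theorem hasDerivAt_glue (hf : ∀ x, HasDerivAt f (f' x) x) (hg : ∀ x, HasDerivAt g (g' x) x)
    (hx : x ≠ 0) : HasDerivAt (glue f g) (glue f' g' x) x := by
  rcases lt_or_gt_of_ne hx with h | h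
  · rw [glue_of_neg h]
    apply (hf x).congr_of_eventuallyEq
    filter_upwards [Iio_mem_nhds h] with y hy using glue_of_neg hy
  · rw [glue_of_nonneg h.le]
    apply (hg x).congr_of_eventuallyEq
    filter_upwards [Ioi_mem_nhds h] with y hy using glue_of_nonneg (le_of_lt hy)

theorem ae_mu_of_forall_mem {P : ℝ → Prop} (h : ∀ x ∈ Ioo (-1 : ℝ) 1, P x) : ∀ᵐ x ∂mu, P x :=
  ae_restrict_of_forall_mem measurableSet_Ioo h

theorem memLp_glue (hf : Continuous f) (hg : Continuous g) : MemLp (glue f g) 2 mu := by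
  obtain ⟨C, hC⟩ := (isCompact_Icc (a := (-1 : ℝ)) (b := 1)).exists_bound_of_continuousOn
    hf.continuousOn
  obtain ⟨D, hD⟩ := (isCompact_Icc (a := (-1 : ℝ)) (b := 1)).exists_bound_of_continuousOn
    hg.continuousOn
  have hmeas : Measurable (glue f g) := Measurable.ite measurableSet_Ici hg.measurable hf.measurable
  refine MemLp.of_bound hmeas.aestronglyMeasurable (max C D)
    (ae_mu_of_forall_mem fun x hx => ?_)
  rcases le_or_gt 0 x with h | h
  · rw [glue_of_nonneg h]
    exact (hD x (Ioo_subset_Icc_self hx)).trans (le_max_right _ _)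
  · rw [glue_of_neg h]
    exact (hC x (Ioo_subset_Icc_self hx)).trans (le_max_left _ _)

theorem memLp_of_continuous (hf : Continuous f) : MemLp f 2 mu := by
  simpa only [glue_self] using memLp_glue hf hf

theorem IsTest.eq_zero_of_notMem {φ : ℝ → ℝ} (hφ : IsTest φ) (hx : x ∉ Ioo (-1 : ℝ) 1) :
    φ x = 0 :=
  image_eq_zero_of_notMem_tsupport fun h => hx (hφ.2.2 h)

theorem IsTest.hasDerivAt {φ : ℝ → ℝ} (hφ : IsTest φ) (x : ℝ) : HasDerivAt φ (deriv φ x) x :=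
  (hφ.1.differentiable (by simp) x).hasDerivAt

theorem isWeakDeriv_of_glue (hf : ∀ x, HasDerivAt f (f' x) x) (hg : ∀ x, HasDerivAt g (g' x) x)
    (h0 : f 0 = g 0) {F G : L2} (hF : F =ᵐ[mu] glue f g) (hG : G =ᵐ[mu] glue f' g') :
    IsWeakDeriv F G := by
  intro φ hφ
  have cf : Continuous f := continuous_iff_continuousAt.2 fun x => (hf x).continuousAt
  have cg : Continuous g := continuous_iff_continuousAt.2 fun x => (hg x).continuousAt
  have hint : Integrable (fun x => deriv φ x • F x + φ x • G x) mu :=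
    (hφ.deriv_test.integrable_smul F.integrable).add (hφ.integrable_smul G.integrable)
  have hae : (fun x => deriv φ x • F x + φ x • G x) =ᵐ[mu]
      fun x => deriv φ x • glue f g x + φ x • glue f' g' x := by
    filter_upwards [hF, hG] with x hFx hGx
    rw [hFx, hGx]
  rw [eq_neg_iff_add_eq_zero, ← integral_add (hφ.deriv_test.integrable_smul F.integrable)
    (hφ.integrable_smul G.integrable), integral_congr_ae hae, ← integral_Ioc_eq_integral_Ioo,
    ← intervalIntegral.integral_of_le (by norm_num),
    integral_eq_of_hasDerivAt_off_countable (fun x => φ x • glue f g x) _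
      (countable_singleton (0 : ℝ))
      (hφ.1.continuous.smul (continuous_glue cf cg h0)).continuousOn
      (fun x hx => ((hφ.hasDerivAt x).smul (hasDerivAt_glue hf hg hx.2)).congr_deriv
        (add_comm _ _))
      ((intervalIntegrable_iff_integrableOn_Ioo_of_le (by norm_num)).2 (hint.congr hae)),
    hφ.eq_zero_of_notMem right_notMem_Ioo, hφ.eq_zero_of_notMem left_notMem_Ioo,
    zero_smul, zero_smul, sub_zero]

theorem isWeakDeriv_of_hasDerivAt (hf : ∀ x, HasDerivAt f (f' x) x) {F G : L2} (hF : F =ᵐ[mu] f)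
    (hG : G =ᵐ[mu] f') : IsWeakDeriv F G :=
  isWeakDeriv_of_glue hf hf rfl (by rwa [glue_self]) (by rwa [glue_self])

end Piecewise

section Primitive

/-- The constant function `1` as an element of `L²(-1, 1)`; `inner ℂ one f` is the integral of
`f`. -/
def one : L2 := Lp.const 2 mu (1 : ℂ)

theorem one_coeFn : one =ᵐ[mu] fun _ => (1 : ℂ) := Lp.coeFn_const 2 mu 1

theorem inner_one (f : L2) : inner ℂ one f = ∫ x, f x ∂mu := by
  rw [L2.inner_def]
  refine integral_congr_ae (one_coeFn.mono fun x hx => ?_)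
  simp only [hx, RCLike.inner_apply, map_one, mul_one]

theorem inner_one_one : inner ℂ one one = 2 := by
  rw [inner_one, integral_congr_ae one_coeFn, integral_const]
  norm_num [Measure.real]

theorem eq_smul_one {f : L2} {C : ℂ} (h : f =ᵐ[mu] fun _ => C) : f = C • one := by
  apply Lp.ext
  filter_upwards [h, Lp.coeFn_smul C one, one_coeFn] with x hf hC h1
  rw [hf, hC, Pi.smul_apply, h1, smul_eq_mul, mul_one]

/-- The continuous representative of the primitive of `f` which vanishes at `-1`. -/
def primFun (f : L2) (x : ℝ) : ℂ := ∫ t in (-1 : ℝ)..x, f t ∂mu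

variable {f g : L2} {x : ℝ}

theorem L2.intervalIntegrable (f : L2) (a b : ℝ) : IntervalIntegrable f mu a b :=
  f.integrable.intervalIntegrable

theorem continuous_primFun (f : L2) : Continuous (primFun f) :=
  intervalIntegral.continuous_primitive f.intervalIntegrable (-1)

theorem primFun_neg_one (f : L2) : primFun f (-1) = 0 := intervalIntegral.integral_same

theorem primFun_one (f : L2) : primFun f 1 = inner ℂ one f := by
  rw [inner_one, primFun, intervalIntegral.integral_of_le (by norm_num),
    Measure.restrict_restrict measurableSet_Ioc, inter_eq_right.2 Ioo_subset_Ioc_self]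

theorem primFun_congr {u : ℝ → ℂ} (h : f =ᵐ[mu] u) (hx : x ∈ Ioo (-1 : ℝ) 1) :
    primFun f x = ∫ t in (-1 : ℝ)..x, u t := by
  rw [primFun, intervalIntegral.integral_of_le hx.1.le, intervalIntegral.integral_of_le hx.1.le,
    integral_congr_ae (ae_restrict_of_ae h), Measure.restrict_restrict measurableSet_Ioc,
    inter_eq_left.2 (Ioc_subset_Ioo_right hx.2)]

theorem primFun_eq_inner (f : L2) (hx : -1 ≤ x) : primFun f x =
    inner ℂ (indicatorConstLp 2 (measurableSet_Ioc (a := -1) (b := x))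
      (measure_ne_top mu _) (1 : ℂ)) f := by
  rw [primFun, intervalIntegral.integral_of_le hx, L2.inner_indicatorConstLp_one]

theorem norm_primFun_le (f : L2) (hx : -1 ≤ x) : ‖primFun f x‖ ≤ √2 * ‖f‖ := by
  have hmu : mu.real (Ioc (-1) x) ≤ 2 := by
    refine (measureReal_mono (subset_univ _)).trans_eq ?_
    norm_num [Measure.real]
  rw [primFun_eq_inner f hx]
  refine (norm_inner_le_norm _ _).trans (mul_le_mul_of_nonneg_right ?_ (norm_nonneg f))
  rw [norm_indicatorConstLp (by norm_num) (by norm_num), norm_one, one_mul, Real.sqrt_eq_rpow,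
    ENNReal.toReal_ofNat]
  gcongr

theorem primFun_add (f g : L2) (hx : -1 ≤ x) : primFun (f + g) x = primFun f x + primFun g x := by
  simp only [primFun_eq_inner _ hx, inner_add_right]

theorem primFun_smul (r : ℂ) (f : L2) (hx : -1 ≤ x) : primFun (r • f) x = r • primFun f x := by
  simp only [primFun_eq_inner _ hx, inner_smul_right, smul_eq_mul]

theorem memLp_primFun (f : L2) : MemLp (primFun f) 2 mu :=
  memLp_of_continuous (continuous_primFun f)

/-- The Volterra operator on `L²(-1, 1)`, which maps `f` to its primitive vanishing at `-1`. -/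
def prim : L2 →L[ℂ] L2 :=
  LinearMap.mkContinuousOfExistsBound
    { toFun := fun f => (memLp_primFun f).toLp
      map_add' := fun f g => (MemLp.toLp_congr _ ((memLp_primFun f).add (memLp_primFun g))
        (ae_mu_of_forall_mem fun _ hx => primFun_add f g hx.1.le)).trans (MemLp.toLp_add _ _)
      map_smul' := fun r f => (MemLp.toLp_congr _ ((memLp_primFun f).const_smul r)
        (ae_mu_of_forall_mem fun _ hx => primFun_smul r f hx.1.le)).trans
          (MemLp.toLp_const_smul _ _) }
    ⟨(measureUnivNNReal mu : ℝ) ^ (2 : ENNReal).toReal⁻¹ * √2, fun f => by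
      rw [mul_assoc]
      refine Lp.norm_le_of_ae_bound (by positivity) ?_
      filter_upwards [(memLp_primFun f).coeFn_toLp, ae_restrict_mem measurableSet_Ioo]
        with x hx hmem
      exact (congrArg norm hx).trans_le (norm_primFun_le f hmem.1.le)⟩

theorem prim_coeFn (f : L2) : prim f =ᵐ[mu] primFun f := (memLp_primFun f).coeFn_toLp

/-- A test function as an element of `L²(-1, 1)`. -/
def IsTest.toL2 {φ : ℝ → ℝ} (h : IsTest φ) : L2 :=
  (memLp_of_continuous (f := fun x => (φ x : ℂ))
    (Complex.continuous_ofReal.comp h.1.continuous)).toLp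

theorem IsTest.toL2_coeFn {φ : ℝ → ℝ} (h : IsTest φ) : h.toL2 =ᵐ[mu] fun x => (φ x : ℂ) :=
  MemLp.coeFn_toLp _

theorem IsTest.inner_toL2 {φ : ℝ → ℝ} (h : IsTest φ) (f : L2) :
    inner ℂ h.toL2 f = ∫ x, φ x • f x ∂mu := by
  rw [L2.inner_def]
  refine integral_congr_ae (h.toL2_coeFn.mono fun x hx => ?_)
  simp only [hx, RCLike.inner_apply, Complex.conj_ofReal, Complex.real_smul, mul_comm]

theorem isWeakDeriv_iff : IsWeakDeriv f g ↔
    ∀ (φ : ℝ → ℝ) (h : IsTest φ), inner ℂ h.deriv_test.toL2 f = -inner ℂ h.toL2 g := by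
  refine forall₂_congr fun φ h => ?_
  rw [h.inner_toL2, h.deriv_test.inner_toL2]

theorem IsTest.isWeakDeriv_toL2 {φ : ℝ → ℝ} (h : IsTest φ) :
    IsWeakDeriv h.toL2 h.deriv_test.toL2 :=
  isWeakDeriv_of_hasDerivAt (fun x => (h.hasDerivAt x).ofReal_comp) h.toL2_coeFn
    h.deriv_test.toL2_coeFn

theorem IsTest.prim_deriv {φ : ℝ → ℝ} (h : IsTest φ) : prim h.deriv_test.toL2 = h.toL2 := by
  apply Lp.ext
  refine (prim_coeFn _).trans (EventuallyEq.trans ?_ h.toL2_coeFn.symm)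
  refine ae_mu_of_forall_mem fun x hx => ?_
  rw [primFun_congr h.deriv_test.toL2_coeFn hx,
    intervalIntegral.integral_eq_sub_of_hasDerivAt (fun t _ => (h.hasDerivAt t).ofReal_comp)
      ((Complex.continuous_ofReal.comp h.deriv_test.1.continuous).intervalIntegrable _ _),
    h.eq_zero_of_notMem left_notMem_Ioo, Complex.ofReal_zero, sub_zero]

/-- The span of the derivatives of test functions; it is dense in the space of functions of mean
zero. -/
def testDerivs : Submodule ℂ L2 :=
  Submodule.span ℂ {f | ∃ (φ : ℝ → ℝ) (h : IsTest φ), f = h.deriv_test.toL2}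

theorem mem_closure_testDerivs (hf : inner ℂ one f = 0) : f ∈ testDerivs.topologicalClosure := by
  rw [← Submodule.orthogonal_orthogonal_eq_closure]
  intro g hg
  have hg0 : IsWeakDeriv g 0 := isWeakDeriv_iff.2 fun φ h => by
    rw [inner_zero_right, neg_zero]
    exact hg _ (Submodule.subset_span ⟨φ, h, rfl⟩)
  obtain ⟨C, hC⟩ := hg0.const_of_zero
  rw [eq_smul_one hC, inner_smul_left, hf, mul_zero]

theorem apply_eq_zero_of_forall_isTest (Λ : L2 →L[ℂ] ℂ)
    (hΛ : ∀ (φ : ℝ → ℝ) (h : IsTest φ), Λ h.deriv_test.toL2 = 0) (hf : inner ℂ one f = 0) :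
    Λ f = 0 := by
  have hle : testDerivs ≤ LinearMap.ker (Λ : L2 →ₗ[ℂ] ℂ) := by
    refine Submodule.span_le.2 ?_
    rintro _ ⟨φ, h, rfl⟩
    exact hΛ φ h
  exact Submodule.topologicalClosure_minimal _ hle Λ.isClosed_ker (mem_closure_testDerivs hf)

/-- The orthogonal projection of `L²(-1, 1)` onto the functions of mean zero. -/
def meanFree : L2 →L[ℂ] L2 :=
  ContinuousLinearMap.id ℂ L2 - ((2⁻¹ : ℂ) • innerSL ℂ one).smulRight one

theorem meanFree_apply (f : L2) : meanFree f = f - (2⁻¹ * inner ℂ one f) • one := rfl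

theorem inner_one_meanFree (f : L2) : inner ℂ one (meanFree f) = 0 := by
  rw [meanFree_apply, inner_sub_right, inner_smul_right, inner_one_one]
  ring

theorem isWeakDeriv_prim_one : IsWeakDeriv (prim one) one := by
  refine isWeakDeriv_of_hasDerivAt (f := fun x => ((x + 1 : ℝ) : ℂ)) (f' := fun _ => 1)
    (fun x => by simpa using ((hasDerivAt_id x).add_const 1).ofReal_comp)
    ((prim_coeFn one).trans (ae_mu_of_forall_mem fun x hx => ?_)) one_coeFn
  rw [primFun_congr one_coeFn hx, intervalIntegral.integral_const, sub_neg_eq_add,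
    Complex.real_smul, mul_one]

theorem isWeakDeriv_prim_of_inner_one_eq_zero (hf : inner ℂ one f = 0) :
    IsWeakDeriv (prim f) f := by
  refine isWeakDeriv_iff.2 fun φ hφ => eq_neg_of_add_eq_zero_left ?_
  refine apply_eq_zero_of_forall_isTest
    (innerSL ℂ hφ.deriv_test.toL2 ∘L prim + innerSL ℂ hφ.toL2) (fun ψ hψ => ?_) hf
  change inner ℂ hφ.deriv_test.toL2 (prim hψ.deriv_test.toL2) +
    inner ℂ hφ.toL2 hψ.deriv_test.toL2 = 0
  rw [hψ.prim_deriv, ← eq_neg_iff_add_eq_zero]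
  exact isWeakDeriv_iff.1 hψ.isWeakDeriv_toL2 φ hφ

theorem isWeakDeriv_prim (f : L2) : IsWeakDeriv (prim f) f := by
  have h := (isWeakDeriv_prim_of_inner_one_eq_zero (inner_one_meanFree f)).add
    (isWeakDeriv_prim_one.smul (2⁻¹ * inner ℂ one f))
  rwa [← map_smul, ← map_add, meanFree_apply, sub_add_cancel] at h

theorem prim_mem_H10 (hf : inner ℂ one f = 0) : prim f ∈ H10 :=
  ⟨⟨f, isWeakDeriv_prim f⟩, primFun f, (continuous_primFun f).continuousOn, prim_coeFn f,
    primFun_neg_one f, by rw [primFun_one, hf]⟩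

theorem weakDeriv_eq {f : H1} (h : IsWeakDeriv f g) : weakDeriv f = g :=
  (weakDeriv_spec f).unique h

theorem weakDeriv₀_spec (f : H10) : IsWeakDeriv f (weakDeriv₀ f) :=
  weakDeriv_spec (Submodule.inclusion H10_le_H1 f)

theorem weakDeriv₀_eq {f : H10} (h : IsWeakDeriv f g) : weakDeriv₀ f = g :=
  (weakDeriv₀_spec f).unique h

theorem IsWeakDeriv.exists_eqOn_primFun_add (h : IsWeakDeriv f g) {F : ℝ → ℂ}
    (hF : ContinuousOn F (Icc (-1) 1)) (hfF : f =ᵐ[mu] F) :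
    ∃ C : ℂ, EqOn F (fun x => primFun g x + C) (Icc (-1) 1) := by
  have hdiff : IsWeakDeriv (f + (-1 : ℂ) • prim g) 0 := by
    simpa only [neg_one_smul, add_neg_cancel] using h.add ((isWeakDeriv_prim g).smul (-1))
  obtain ⟨C, hC⟩ := hdiff.const_of_zero
  have hae : F =ᵐ[mu] fun x => primFun g x + C := by
    filter_upwards [hC, Lp.coeFn_add f ((-1 : ℂ) • prim g), Lp.coeFn_smul (-1 : ℂ) (prim g),
      prim_coeFn g, hfF] with x hCx hadd hsmul hprim hfx
    rw [← hCx, hadd, Pi.add_apply, hsmul, Pi.smul_apply, hprim, hfx, neg_one_smul]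
    abel
  rw [mu, Measure.restrict_congr_set Ioo_ae_eq_Icc] at hae
  exact ⟨C, Measure.eqOn_Icc_of_ae_eq volume (by norm_num) hae hF
    ((continuous_primFun g).add continuous_const).continuousOn⟩

theorem exists_eqOn_primFun_weakDeriv₀ (f : H10) :
    ∃ F : ℝ → ℂ, f =ᵐ[mu] F ∧ F 1 = 0 ∧ EqOn F (primFun (weakDeriv₀ f)) (Icc (-1) 1) := by
  obtain ⟨-, F, hF, hfF, hF_neg_one, hF_one⟩ := f.2
  obtain ⟨C, hC⟩ := (weakDeriv₀_spec f).exists_eqOn_primFun_add hF hfF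
  have hC0 : C = 0 := by
    simpa only [hF_neg_one, primFun_neg_one, zero_add, eq_comm] using
      hC (x := -1) ⟨le_rfl, by norm_num⟩
  exact ⟨F, hfF, hF_one, fun x hx => by simpa only [hC0, add_zero] using hC hx⟩

theorem prim_weakDeriv₀ (f : H10) : prim (weakDeriv₀ f) = f := by
  obtain ⟨F, hfF, -, hF⟩ := exists_eqOn_primFun_weakDeriv₀ f
  apply Lp.ext
  filter_upwards [prim_coeFn (weakDeriv₀ f), hfF, ae_restrict_mem measurableSet_Ioo]
    with x hprim hfx hx
  rw [hprim, hfx, hF (Ioo_subset_Icc_self hx)]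

theorem inner_one_weakDeriv₀ (f : H10) : inner ℂ one (weakDeriv₀ f) = 0 := by
  obtain ⟨F, -, hF_one, hF⟩ := exists_eqOn_primFun_weakDeriv₀ f
  rw [← primFun_one, ← hF ⟨by norm_num, le_rfl⟩, hF_one]

theorem inner_weakDeriv (f : H1) (g : H10) :
    inner ℂ (weakDeriv f) (g : L2) = -inner ℂ (f : L2) (weakDeriv₀ g) := by
  have h : inner ℂ (weakDeriv f) (prim (weakDeriv₀ g)) + inner ℂ (f : L2) (weakDeriv₀ g) = 0 := by
    refine apply_eq_zero_of_forall_isTest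
      (innerSL ℂ (weakDeriv f) ∘L prim + innerSL ℂ (f : L2)) (fun φ hφ => ?_)
      (inner_one_weakDeriv₀ g)
    change inner ℂ (weakDeriv f) (prim hφ.deriv_test.toL2) +
      inner ℂ (f : L2) hφ.deriv_test.toL2 = 0
    rw [hφ.prim_deriv, ← inner_conj_symm, ← inner_conj_symm (f : L2),
      isWeakDeriv_iff.1 (weakDeriv_spec f) φ hφ, map_neg, add_neg_cancel]
  rwa [prim_weakDeriv₀, ← eq_neg_iff_add_eq_zero] at h

end Primitive

/-! ### The wave operator -/

section EnergySpace

open Energy (u1 v1 u2 v2 ofComponents)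

variable {p : Params}

theorem meanFree_eq_self {f : L2} (hf : inner ℂ one f = 0) : meanFree f = f := by
  rw [meanFree_apply, hf, mul_zero, zero_smul, sub_zero]

/-- The element of `H¹₀(-1, 1)` whose weak derivative is the mean free part of `f`. -/
def primZero : L2 →ₗ[ℂ] H10 :=
  LinearMap.codRestrict H10 (prim ∘L meanFree : L2 →L[ℂ] L2).toLinearMap
    fun f => prim_mem_H10 (inner_one_meanFree f)

theorem weakDeriv₀_primZero (f : L2) : weakDeriv₀ (primZero f) = meanFree f :=
  weakDeriv₀_eq (isWeakDeriv_prim (meanFree f))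

theorem Energy.inner_eq (x y : Energy p) :
    inner ℂ x y = inner ℂ (weakDeriv₀ (u1 x)) (weakDeriv₀ (u1 y)) +
      (p.c : ℂ) * inner ℂ (weakDeriv₀ (v1 x)) (weakDeriv₀ (v1 y)) +
      inner ℂ (u2 x) (u2 y) + inner ℂ (v2 x) (v2 y) := rfl

theorem Energy.norm_sq_eq (x : Energy p) :
    ‖x‖ ^ 2 = ‖weakDeriv₀ (u1 x)‖ ^ 2 + p.c * ‖weakDeriv₀ (v1 x)‖ ^ 2 + ‖u2 x‖ ^ 2 +
      ‖v2 x‖ ^ 2 := by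
  simp only [@norm_sq_eq_re_inner ℂ, Energy.inner_eq, map_add, RCLike.re_eq_complex_re,
    Complex.re_ofReal_mul]

/-- The isometric embedding `(u¹, v¹, u², v²) ↦ (u¹ₓ, √c v¹ₓ, u², v²)` of the energy space into
`(L²)⁴`. -/
def grad : Energy p →ₗᵢ[ℂ] PiLp 2 fun _ : Fin 4 => L2 where
  toLinearMap := (WithLp.linearEquiv 2 ℂ (Fin 4 → L2)).symm.toLinearMap ∘ₗ
    LinearMap.pi ![weakDeriv₀ ∘ₗ u1, ((√p.c : ℝ) : ℂ) • weakDeriv₀ ∘ₗ v1, u2, v2]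
  norm_map' x := by
    rw [← sq_eq_sq₀ (norm_nonneg _) (norm_nonneg _), PiLp.norm_sq_eq_of_L2, Energy.norm_sq_eq]
    simp [Fin.sum_univ_four, norm_smul, mul_pow, Real.sq_sqrt p.c_pos.le, -Complex.coe_smul]

theorem grad_apply (x : Energy p) : grad x =
    WithLp.toLp 2 ![weakDeriv₀ (u1 x), ((√p.c : ℝ) : ℂ) • weakDeriv₀ (v1 x), u2 x, v2 x] := by
  ext i : 1
  fin_cases i <;> rfl

theorem range_grad : range (grad : Energy p → PiLp 2 fun _ : Fin 4 => L2) =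
    {z | inner ℂ one (z 0) = 0 ∧ inner ℂ one (z 1) = 0} := by
  ext z
  constructor
  · rintro ⟨x, rfl⟩
    simp [grad_apply, inner_one_weakDeriv₀, inner_smul_right, -Complex.coe_smul]
  · rintro ⟨h0, h1⟩
    have hc : ((√p.c : ℝ) : ℂ) ≠ 0 := Complex.ofReal_ne_zero.2 (Real.sqrt_pos.2 p.c_pos).ne'
    refine ⟨ofComponents (primZero (z 0), ((√p.c : ℝ) : ℂ)⁻¹ • primZero (z 1), z 2, z 3), ?_⟩
    have hu : weakDeriv₀ (primZero (z 0)) = z 0 := by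
      rw [weakDeriv₀_primZero, meanFree_eq_self h0]
    have hv : ((√p.c : ℝ) : ℂ) • weakDeriv₀ (((√p.c : ℝ) : ℂ)⁻¹ • primZero (z 1)) = z 1 := by
      rw [map_smul, weakDeriv₀_primZero, meanFree_eq_self h1, smul_inv_smul₀ hc]
    ext i : 1
    fin_cases i
    exacts [hu, hv, rfl, rfl]

instance : CompleteSpace (Energy p) := by
  rw [completeSpace_iff_isComplete_range grad.isometry.isUniformInducing, range_grad]
  refine IsClosed.isComplete (IsClosed.inter ?_ ?_)
  all_goals
    refine isClosed_eq ?_ continuous_const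
    fun_prop

theorem continuous_weakDeriv₀_u1 : Continuous fun x : Energy p => weakDeriv₀ (u1 x) :=
  (PiLp.continuous_apply 2 _ 0).comp grad.continuous

theorem continuous_weakDeriv₀_v1 : Continuous fun x : Energy p => weakDeriv₀ (v1 x) := by
  have hc : ((√p.c : ℝ) : ℂ) ≠ 0 := Complex.ofReal_ne_zero.2 (Real.sqrt_pos.2 p.c_pos).ne'
  have h : Continuous fun x : Energy p => ((√p.c : ℝ) : ℂ) • weakDeriv₀ (v1 x) :=
    (PiLp.continuous_apply 2 _ 1).comp grad.continuous
  exact (h.const_smul ((√p.c : ℝ) : ℂ)⁻¹).congr fun x => inv_smul_smul₀ hc _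

theorem continuous_u2 : Continuous (u2 : Energy p → L2) :=
  (PiLp.continuous_apply 2 _ 2).comp grad.continuous

theorem continuous_v2 : Continuous (v2 : Energy p → L2) :=
  (PiLp.continuous_apply 2 _ 3).comp grad.continuous

theorem continuous_u1 : Continuous fun x : Energy p => (u1 x : L2) :=
  (prim.continuous.comp continuous_weakDeriv₀_u1).congr fun x => prim_weakDeriv₀ (u1 x)

theorem continuous_v1 : Continuous fun x : Energy p => (v1 x : L2) :=
  (prim.continuous.comp continuous_weakDeriv₀_v1).congr fun x => prim_weakDeriv₀ (v1 x)

theorem Energy.continuous_of_components {X : Type*} [TopologicalSpace X] {f : X → Energy p}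
    (hu1 : Continuous fun t => weakDeriv₀ (u1 (f t)))
    (hv1 : Continuous fun t => weakDeriv₀ (v1 (f t)))
    (hu2 : Continuous fun t => u2 (f t)) (hv2 : Continuous fun t => v2 (f t)) : Continuous f := by
  rw [grad.isometry.isUniformInducing.isInducing.continuous_iff]
  refine (PiLp.continuous_toLp 2 _).comp (continuous_pi fun i => ?_)
  fin_cases i
  exacts [hu1, hv1.const_smul ((√p.c : ℝ) : ℂ), hu2, hv2]

end EnergySpace

section Operator

open Energy (u1 v1 u2 v2 ofComponents)

variable {p : Params}

theorem mem_graph_waveOp_iff {x y : Energy p} : (x, y) ∈ (waveOp p).graph ↔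
    ∃ (U V : H10) (F W : H1), (U : L2) = u2 x ∧ (V : L2) = v2 x ∧
      (F : L2) = weakDeriv₀ (u1 x) + dampMul p (weakDeriv₀ U) ∧ (W : L2) = weakDeriv₀ (v1 x) ∧
      u1 y = U ∧ v1 y = V ∧ u2 y = weakDeriv F - v2 x ∧
      v2 y = (p.c : ℂ) • weakDeriv W + u2 x := by
  rw [LinearPMap.mem_graph_iff]
  constructor
  · rintro ⟨z, rfl, rfl⟩
    exact ⟨domU2 z, domV2 z, domFlux z, domV1x z, rfl, rfl, rfl, rfl, rfl, rfl, rfl, rfl⟩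
  · rintro ⟨U, V, F, W, hU, hV, hF, hW, hu1, hv1, hu2, hv2⟩
    have eU : (⟨u2 x, hU ▸ U.2⟩ : H10) = U := Subtype.ext hU.symm
    have hx : x ∈ waveDomain p :=
      ⟨hU ▸ U.2, hV ▸ V.2, hW ▸ W.2, by rw [eU, ← hF]; exact F.2⟩
    have eF : domFlux ⟨x, hx⟩ = F := Subtype.ext (by rw [hF, ← eU]; rfl)
    have eW : domV1x ⟨x, hx⟩ = W := Subtype.ext (by rw [hW]; rfl)
    refine ⟨⟨x, hx⟩, rfl, Energy.ext (hu1.trans eU.symm).symm ?_ ?_ ?_⟩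
    · exact (hv1.trans (Subtype.ext hV)).symm
    · rw [hu2, ← eF]
      rfl
    · rw [hv2, ← eW]
      rfl

theorem re_inner_dampMul_nonneg (f : L2) : 0 ≤ (inner ℂ f (dampMul p f)).re := by
  have h : inner ℂ f (dampMul p f) =
      ((∫ x, (Icc (0 : ℝ) 1).indicator (fun _ => p.d) x * ‖f x‖ ^ 2 ∂mu : ℝ) : ℂ) := by
    rw [L2.inner_def, ← integral_complex_ofReal]
    refine integral_congr_ae ((dampMul_coeFn p f).mono fun x hx => ?_)
    simp only [hx, RCLike.inner_apply]
    rw [mul_assoc, Complex.mul_conj, Complex.normSq_eq_norm_sq]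
    by_cases hx : x ∈ Icc (0 : ℝ) 1 <;> simp [hx]
  rw [h, Complex.ofReal_re]
  exact integral_nonneg fun x =>
    mul_nonneg (indicator_nonneg (fun _ _ => p.d_pos.le) x) (sq_nonneg _)

theorem re_inner_waveOp_nonpos {x y : Energy p} (h : (x, y) ∈ (waveOp p).graph) :
    (inner ℂ x y).re ≤ 0 := by
  obtain ⟨U, V, F, W, hU, hV, hF, hW, hu1, hv1, hu2, hv2⟩ := mem_graph_waveOp_iff.1 h
  have integrate_by_parts (f : H1) (g : H10) :
      (inner ℂ (g : L2) (weakDeriv f)).re = -(inner ℂ (weakDeriv₀ g) (f : L2)).re := by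
    rw [← inner_conj_symm, inner_weakDeriv, map_neg, inner_conj_symm, Complex.neg_re]
  have symm (f g : L2) : (inner ℂ f g).re = (inner ℂ g f).re := inner_re_symm (𝕜 := ℂ) f g
  have hdamp := re_inner_dampMul_nonneg (p := p) (weakDeriv₀ U)
  rw [Energy.inner_eq, hu1, hv1, hu2, hv2, ← hU, ← hV, ← hW, inner_sub_right, inner_add_right,
    inner_smul_right]
  simp only [Complex.add_re, Complex.sub_re, Complex.re_ofReal_mul, integrate_by_parts]
  rw [hF, inner_add_right, Complex.add_re, symm (V : L2) U, symm (weakDeriv₀ V) W,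
    symm (weakDeriv₀ U) (weakDeriv₀ (u1 x))]
  linarith

theorem norm_dampMul_le (f : L2) : ‖dampMul p f‖ ≤ p.d * ‖f‖ := by
  refine Lp.norm_le_mul_norm_of_ae_le_mul ((dampMul_coeFn p f).mono fun x hx => ?_)
  rw [hx, norm_mul]
  refine mul_le_mul_of_nonneg_right ?_ (norm_nonneg _)
  refine (norm_indicator_le_norm_self _ _).trans_eq ?_
  rw [Complex.norm_real, Real.norm_of_nonneg p.d_pos.le]

/-- The inverse of the wave operator as a linear map. Integrating `(u¹ₓ + a u²ₓ)ₓ = f + v²` and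
`c v¹ₓₓ = g - u²` once leaves a free constant, which the boundary conditions fix: `u¹ₓ` and `v¹ₓ`
are mean free. -/
def waveInvLin (p : Params) : Energy p →ₗ[ℂ] Energy p :=
  ofComponents ∘ₗ
    (primZero ∘ₗ (prim.toLinearMap ∘ₗ (u2 + H10.subtype ∘ₗ v1) -
        dampMul p ∘ₗ weakDeriv₀ ∘ₗ u1)).prod
      (((p.c : ℂ)⁻¹ • primZero ∘ₗ prim.toLinearMap ∘ₗ (v2 - H10.subtype ∘ₗ u1)).prod
        ((H10.subtype ∘ₗ u1).prod (H10.subtype ∘ₗ v1)))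

theorem weakDeriv₀_u1_waveInvLin (y : Energy p) : weakDeriv₀ (u1 (waveInvLin p y)) =
    meanFree (prim (u2 y + (v1 y : L2)) - dampMul p (weakDeriv₀ (u1 y))) :=
  weakDeriv₀_primZero _

theorem weakDeriv₀_v1_waveInvLin (y : Energy p) : weakDeriv₀ (v1 (waveInvLin p y)) =
    (p.c : ℂ)⁻¹ • meanFree (prim (v2 y - (u1 y : L2))) :=
  (map_smul weakDeriv₀ _ _).trans (congrArg _ (weakDeriv₀_primZero _))

/-- The inverse of the wave operator as a bounded operator. -/
def waveInv (p : Params) : Energy p →L[ℂ] Energy p where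
  toLinearMap := waveInvLin p
  cont := by
    have hdamp : Continuous (dampMul p) :=
      AddMonoidHomClass.continuous_of_bound (dampMul p) p.d norm_dampMul_le
    refine Energy.continuous_of_components ?_ ?_ continuous_u1 continuous_v1
    · simp only [AddHom.toFun_eq_coe, LinearMap.coe_toAddHom, weakDeriv₀_u1_waveInvLin]
      exact meanFree.continuous.comp ((prim.continuous.comp (continuous_u2.add continuous_v1)).sub
        (hdamp.comp continuous_weakDeriv₀_u1))
    · simp only [AddHom.toFun_eq_coe, LinearMap.coe_toAddHom, weakDeriv₀_v1_waveInvLin]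
      exact (meanFree.continuous.comp (prim.continuous.comp
        (continuous_v2.sub continuous_u1))).const_smul (p.c : ℂ)⁻¹

theorem isWeakDeriv_one : IsWeakDeriv one 0 :=
  isWeakDeriv_of_hasDerivAt (fun x => hasDerivAt_const x 1) one_coeFn (Lp.coeFn_zero ℂ 2 mu)

theorem isWeakDeriv_prim_sub_smul_one (f : L2) (r : ℂ) : IsWeakDeriv (prim f - r • one) f := by
  have h := (isWeakDeriv_prim f).add (isWeakDeriv_one.smul (-r))
  rwa [smul_zero, add_zero, neg_smul, ← sub_eq_add_neg] at h

theorem waveInv_mem_graph (y : Energy p) : (waveInv p y, y) ∈ (waveOp p).graph := by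
  have hc : (p.c : ℂ) ≠ 0 := Complex.ofReal_ne_zero.2 p.c_pos.ne'
  have hF : IsWeakDeriv (weakDeriv₀ (u1 (waveInvLin p y)) + dampMul p (weakDeriv₀ (u1 y)))
      (u2 y + (v1 y : L2)) := by
    rw [weakDeriv₀_u1_waveInvLin, meanFree_apply, sub_right_comm, sub_add_cancel]
    exact isWeakDeriv_prim_sub_smul_one _ _
  have hW : IsWeakDeriv (weakDeriv₀ (v1 (waveInvLin p y)))
      ((p.c : ℂ)⁻¹ • (v2 y - (u1 y : L2))) := by
    rw [weakDeriv₀_v1_waveInvLin, meanFree_apply]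
    exact (isWeakDeriv_prim_sub_smul_one _ _).smul _
  refine mem_graph_waveOp_iff.2 ⟨u1 y, v1 y, ⟨_, _, hF⟩, ⟨_, _, hW⟩, rfl, rfl, rfl, rfl, rfl, rfl,
    ?_, ?_⟩
  · rw [weakDeriv_eq hF]
    exact (add_sub_cancel_right _ _).symm
  · rw [weakDeriv_eq hW, smul_inv_smul₀ hc]
    exact (sub_add_cancel _ _).symm

theorem eq_zero_of_mem_graph_waveOp {x : Energy p} (h : (x, 0) ∈ (waveOp p).graph) : x = 0 := by
  obtain ⟨U, V, F, W, hU, hV, hF, hW, hu1, hv1, hu2, hv2⟩ := mem_graph_waveOp_iff.1 h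
  rw [map_zero] at hu1 hv1 hu2 hv2
  rw [← hu1, ZeroMemClass.coe_zero] at hU
  rw [← hv1, ZeroMemClass.coe_zero] at hV
  rw [← hu1, map_zero, map_zero, add_zero] at hF
  rw [← hV, sub_zero] at hu2
  rw [← hU, add_zero, eq_comm,
    smul_eq_zero_iff_right (Complex.ofReal_ne_zero.2 p.c_pos.ne')] at hv2
  have hu := inner_weakDeriv F (u1 x)
  rw [← hu2, inner_zero_left, hF, eq_comm, neg_eq_zero, inner_self_eq_zero] at hu
  have hv := inner_weakDeriv W (v1 x)
  rw [hv2, inner_zero_left, hW, eq_comm, neg_eq_zero, inner_self_eq_zero] at hv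
  refine Energy.ext ?_ ?_ hU.symm hV.symm
  · exact weakDeriv₀_injective (hu.trans (map_zero _).symm)
  · exact weakDeriv₀_injective (hv.trans (map_zero _).symm)

theorem mem_graph_waveOp_iff_eq_waveInv {x y : Energy p} :
    (x, y) ∈ (waveOp p).graph ↔ x = waveInv p y := by
  refine ⟨fun h => ?_, fun h => h ▸ waveInv_mem_graph y⟩
  have hsub := (waveOp p).graph.sub_mem h (waveInv_mem_graph y)
  rw [Prod.mk_sub_mk, sub_self] at hsub
  exact sub_eq_zero.1 (eq_zero_of_mem_graph_waveOp hsub)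

theorem exists_hasGenerator_waveOp (p : Params) :
    ∃ S : C0Semigroup (Energy p), S.HasGenerator (waveOp p) :=
  have hG : IsDissipative (waveInv p) := fun y => re_inner_waveOp_nonpos (waveInv_mem_graph y)
  hG.exists_hasGenerator fun _ _ => mem_graph_waveOp_iff_eq_waveInv

end Operator

/-! ### Approximate eigenvectors on the imaginary axis -/

section Modes

theorem norm_le_sqrt_two_mul_of_ae_bound {f : L2} {C : ℝ} (hC : 0 ≤ C)
    (h : ∀ᵐ x ∂mu, ‖f x‖ ≤ C) : ‖f‖ ≤ √2 * C := by
  refine (Lp.norm_le_of_ae_bound hC h).trans_eq ?_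
  have hmu : (measureUnivNNReal mu : ℝ) = 2 := by
    rw [measureUnivNNReal, ENNReal.coe_toNNReal_eq_toReal, Measure.restrict_apply_univ,
      Real.volume_Ioo]
    norm_num
  rw [hmu, Real.sqrt_eq_rpow, ENNReal.toReal_ofNat, one_div]

/-- The function `sin (k x)` in `L²(-1, 1)`. -/
def sinL2 (k : ℝ) : L2 :=
  (memLp_of_continuous (f := fun x : ℝ => Complex.sin (k * x)) (by fun_prop)).toLp

/-- The function `cos (k x)` in `L²(-1, 1)`. -/
def cosL2 (k : ℝ) : L2 :=
  (memLp_of_continuous (f := fun x : ℝ => Complex.cos (k * x)) (by fun_prop)).toLp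

theorem sinL2_coeFn (k : ℝ) : sinL2 k =ᵐ[mu] fun x => Complex.sin (k * x) := MemLp.coeFn_toLp _

theorem cosL2_coeFn (k : ℝ) : cosL2 k =ᵐ[mu] fun x => Complex.cos (k * x) := MemLp.coeFn_toLp _

theorem hasDerivAt_ofReal_mul (k x : ℝ) : HasDerivAt (fun x : ℝ => (k : ℂ) * x) k x := by
  simpa using (Complex.ofRealCLM.hasDerivAt (x := x)).const_mul (k : ℂ)

theorem hasDerivAt_sin_mul (k x : ℝ) :
    HasDerivAt (fun x : ℝ => Complex.sin (k * x)) (k * Complex.cos (k * x)) x := by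
  rw [mul_comm (k : ℂ)]
  exact (Complex.hasDerivAt_sin _).comp x (hasDerivAt_ofReal_mul k x)

theorem hasDerivAt_cos_mul (k x : ℝ) :
    HasDerivAt (fun x : ℝ => Complex.cos (k * x)) (-k * Complex.sin (k * x)) x := by
  rw [neg_mul, mul_comm (k : ℂ), ← neg_mul]
  exact (Complex.hasDerivAt_cos _).comp x (hasDerivAt_ofReal_mul k x)

theorem isWeakDeriv_sinL2 (k : ℝ) : IsWeakDeriv (sinL2 k) ((k : ℂ) • cosL2 k) := by
  refine isWeakDeriv_of_hasDerivAt (hasDerivAt_sin_mul k) (sinL2_coeFn k) ?_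
  filter_upwards [Lp.coeFn_smul (k : ℂ) (cosL2 k), cosL2_coeFn k] with x hsmul hcos
  rw [hsmul, Pi.smul_apply, hcos, smul_eq_mul]

theorem isWeakDeriv_cosL2 (k : ℝ) : IsWeakDeriv (cosL2 k) (-(k : ℂ) • sinL2 k) := by
  refine isWeakDeriv_of_hasDerivAt (hasDerivAt_cos_mul k) (cosL2_coeFn k) ?_
  filter_upwards [Lp.coeFn_smul (-(k : ℂ)) (sinL2 k), sinL2_coeFn k] with x hsmul hsin
  rw [hsmul, Pi.smul_apply, hsin, smul_eq_mul]

theorem sinL2_mem_H10 {k : ℝ} (hk : Real.sin k = 0) : sinL2 k ∈ H10 := by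
  have h : Complex.sin k = 0 := by rw [← Complex.ofReal_sin, hk, Complex.ofReal_zero]
  exact ⟨⟨_, isWeakDeriv_sinL2 k⟩, fun x : ℝ => Complex.sin (k * x), by fun_prop, sinL2_coeFn k,
    by simp [h], by simp [h]⟩

theorem norm_sinL2 {k : ℝ} (hk0 : k ≠ 0) (hk : Real.sin k = 0) : ‖sinL2 k‖ = 1 := by
  have hinner : inner ℂ (sinL2 k) (sinL2 k) =
      ((∫ x in (-1 : ℝ)..1, Real.sin (k * x) ^ 2 : ℝ) : ℂ) := by
    rw [L2.inner_def, ← intervalIntegral.integral_ofReal,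
      intervalIntegral.integral_of_le (by norm_num), integral_Ioc_eq_integral_Ioo]
    refine integral_congr_ae ((sinL2_coeFn k).mono fun x hx => ?_)
    simp only [hx, RCLike.inner_apply]
    rw [← Complex.ofReal_mul, ← Complex.ofReal_sin, Complex.conj_ofReal, ← sq, Complex.ofReal_pow]
  have hint : ∫ x in (-1 : ℝ)..1, Real.sin (k * x) ^ 2 = 1 := by
    rw [intervalIntegral.integral_comp_mul_left (fun x => Real.sin x ^ 2) hk0, integral_sin_sq]
    simp only [mul_neg, mul_one, Real.sin_neg, hk, smul_eq_mul]
    field_simp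
    ring
  rw [← pow_eq_one_iff_of_nonneg (norm_nonneg _) two_ne_zero, norm_sq_eq_re_inner (𝕜 := ℂ), hinner,
    hint, RCLike.re_eq_complex_re, Complex.ofReal_re]

end Modes

section ApproximateEigenvectors

open Energy (u1 v1 u2 v2 ofComponents)

variable {p : Params} {k l : ℝ}

/-- The factor by which the damping multiplies `uₓ` in the flux of `e^{ilt} u(x)` on `(0, 1)`. -/
def dampFactor (d l : ℝ) : ℂ := 1 + Complex.I * l * d

theorem dampFactor_re (d l : ℝ) : (dampFactor d l).re = 1 := by simp [dampFactor]

theorem dampFactor_im (d l : ℝ) : (dampFactor d l).im = l * d := by simp [dampFactor]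

theorem dampFactor_ne_zero (d l : ℝ) : dampFactor d l ≠ 0 := fun h => by
  simpa [dampFactor_re] using congrArg Complex.re h

theorem Energy.norm_v2_le (x : Energy p) : ‖v2 x‖ ≤ ‖x‖ := by
  have hc := p.c_pos.le
  rw [← sq_le_sq₀ (norm_nonneg _) (norm_nonneg _), Energy.norm_sq_eq]
  exact le_add_of_nonneg_left (by positivity)

theorem Energy.norm_ofComponents_v2 (f : L2) :
    ‖(ofComponents (0, 0, 0, f) : Energy p)‖ = ‖f‖ := by
  rw [← sq_eq_sq₀ (norm_nonneg _) (norm_nonneg _), Energy.norm_sq_eq]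
  change ‖weakDeriv₀ 0‖ ^ 2 + p.c * ‖weakDeriv₀ 0‖ ^ 2 + ‖(0 : L2)‖ ^ 2 + ‖f‖ ^ 2 = _
  simp only [map_zero, norm_zero, zero_pow two_ne_zero, mul_zero, zero_add]

/-- The initial state of the motion `u = e^{ilt} U`, `v = e^{ilt} sin (k x) / l`. -/
def modeState (p : Params) (l : ℝ) (U : H10) {k : ℝ} (hk : Real.sin k = 0) : Energy p :=
  ofComponents (U, (l : ℂ)⁻¹ • ⟨sinL2 k, sinL2_mem_H10 hk⟩, (Complex.I * l) • (U : L2),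
    Complex.I • sinL2 k)

theorem one_le_norm_modeState (hk0 : k ≠ 0) (hk : Real.sin k = 0) (l : ℝ) (U : H10) :
    1 ≤ ‖modeState p l U hk‖ := by
  refine le_of_eq_of_le ?_ (Energy.norm_v2_le _)
  change 1 = ‖Complex.I • sinL2 k‖
  rw [norm_smul, norm_sinL2 hk0 hk, Complex.norm_I, one_mul]

theorem modeState_mem_graph (hl : l ≠ 0) (hk : Real.sin k = 0)
    (hkl : p.c * k ^ 2 = l ^ 2) {U : H10} {F : H1}
    (hF : (F : L2) = weakDeriv₀ U + dampMul p (weakDeriv₀ ((Complex.I * l) • U)))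
    (hF' : weakDeriv F = Complex.I • sinL2 k - (l : ℂ) ^ 2 • (U : L2)) :
    (modeState p l U hk, (Complex.I * l) • modeState p l U hk +
      ofComponents (0, 0, 0, (Complex.I * l) • (U : L2))) ∈ (waveOp p).graph := by
  have hlc : (l : ℂ) ≠ 0 := Complex.ofReal_ne_zero.2 hl
  have hklc : (p.c : ℂ) * k ^ 2 = l ^ 2 := by exact_mod_cast hkl
  have hW := (isWeakDeriv_cosL2 k).smul ((l : ℂ)⁻¹ * k)
  have hv : weakDeriv₀ ((l : ℂ)⁻¹ • ⟨sinL2 k, sinL2_mem_H10 hk⟩) = ((l : ℂ)⁻¹ * k) • cosL2 k := by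
    rw [map_smul, weakDeriv₀_eq (isWeakDeriv_sinL2 k), smul_smul]
  refine mem_graph_waveOp_iff.2 ⟨(Complex.I * l) • U,
    Complex.I • ⟨sinL2 k, sinL2_mem_H10 hk⟩, F, ⟨_, _, hW⟩, rfl, rfl, hF, hv.symm, ?_, ?_, ?_, ?_⟩
  · exact add_zero _
  · refine (add_zero _).trans ?_
    change (Complex.I * l) • (l : ℂ)⁻¹ • _ = _
    rw [smul_smul, mul_inv_cancel_right₀ hlc]
  · refine (add_zero _).trans ?_
    change (Complex.I * l) • (Complex.I * l) • (U : L2) = weakDeriv F - Complex.I • sinL2 k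
    rw [hF', sub_sub_cancel_left, smul_smul, ← neg_smul]
    congr 1
    linear_combination (l : ℂ) ^ 2 * Complex.I_sq
  · change (Complex.I * l) • Complex.I • sinL2 k + (Complex.I * l) • (U : L2) =
      (p.c : ℂ) • weakDeriv ⟨_, _, hW⟩ + (Complex.I * l) • (U : L2)
    rw [weakDeriv_eq hW, smul_smul, smul_smul, smul_smul]
    congr 2
    field_simp
    linear_combination hklc + (l : ℂ) ^ 2 * Complex.I_sq

theorem one_le_mul_norm_of_resolvent_bound {K : ℝ}
    (hK : ∀ x y, (x, y) ∈ (waveOp p).graph → ∀ l : ℝ, ‖x‖ ≤ K * ‖y - (Complex.I * l) • x‖)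
    (hl : 0 < l) (hk0 : k ≠ 0) (hk : Real.sin k = 0) (hkl : p.c * k ^ 2 = l ^ 2) {U : H10} {F : H1}
    (hF : (F : L2) = weakDeriv₀ U + dampMul p (weakDeriv₀ ((Complex.I * l) • U)))
    (hF' : weakDeriv F = Complex.I • sinL2 k - (l : ℂ) ^ 2 • (U : L2)) :
    1 ≤ K * (l * ‖(U : L2)‖) := by
  have h := (one_le_norm_modeState hk0 hk l U).trans
    (hK _ _ (modeState_mem_graph hl.ne' hk hkl hF hF') l)
  rwa [add_sub_cancel_left, Energy.norm_ofComponents_v2, norm_smul, norm_mul, Complex.norm_I,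
    one_mul, Complex.norm_real, Real.norm_of_nonneg hl.le] at h

theorem eq_add_dampMul_of_glue {g₁ g₂ : ℝ → ℂ} {F G : L2} (hF : F =ᵐ[mu] glue g₁ g₂)
    (hG : G =ᵐ[mu] glue g₁ fun x => (dampFactor p.d l)⁻¹ * g₂ x) :
    F = G + dampMul p ((Complex.I * l) • G) := by
  apply Lp.ext
  filter_upwards [hF, hG, Lp.coeFn_add G (dampMul p ((Complex.I * l) • G)),
    dampMul_coeFn p ((Complex.I * l) • G), Lp.coeFn_smul (Complex.I * l) G,
    ae_mu_of_forall_mem fun x hx => hx] with x hFx hGx hadd hdamp hsmul hx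
  rw [hFx, hadd, Pi.add_apply, hdamp, hsmul, Pi.smul_apply, hGx, smul_eq_mul]
  rcases le_or_gt 0 x with h | h
  · have hD := mul_inv_cancel₀ (dampFactor_ne_zero p.d l)
    rw [glue_of_nonneg h, glue_of_nonneg h,
      indicator_of_mem (show x ∈ Icc (0 : ℝ) 1 from ⟨h, hx.2.le⟩)]
    rw [dampFactor] at hD ⊢
    linear_combination -g₂ x * hD
  · rw [glue_of_neg h, glue_of_neg h, indicator_of_notMem (fun hh => (not_le.2 h) hh.1), zero_mul,
      add_zero]

theorem norm_le_of_glue {f₁ f₂ : ℝ → ℂ} {F : L2} {B : ℝ} (hF : F =ᵐ[mu] glue f₁ f₂)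
    (h₁ : ∀ x ∈ Icc (-1 : ℝ) 0, ‖f₁ x‖ ≤ B) (h₂ : ∀ x ∈ Icc (0 : ℝ) 1, ‖f₂ x‖ ≤ B) :
    ‖F‖ ≤ √2 * B := by
  refine norm_le_sqrt_two_mul_of_ae_bound
    ((norm_nonneg _).trans (h₁ 0 (right_mem_Icc.2 (by norm_num)))) ?_
  filter_upwards [hF, ae_mu_of_forall_mem fun x hx => hx] with x hFx hx
  rw [hFx]
  rcases le_or_gt 0 x with h | h
  · rw [glue_of_nonneg h]
    exact h₂ x ⟨h, hx.2.le⟩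
  · rw [glue_of_neg h]
    exact h₁ x ⟨hx.1.le, h.le⟩

theorem exists_mem_H10_of_transmission {B : ℝ} {φ f₁ f₂ g₁ g₂ : ℝ → ℂ} {Φ : L2}
    (hΦ : Φ =ᵐ[mu] φ)
    (hf₁ : ∀ x, HasDerivAt f₁ (g₁ x) x)
    (hf₂ : ∀ x, HasDerivAt f₂ ((dampFactor p.d l)⁻¹ * g₂ x) x)
    (hg₁ : ∀ x, HasDerivAt g₁ (φ x - l ^ 2 * f₁ x) x)
    (hg₂ : ∀ x, HasDerivAt g₂ (φ x - l ^ 2 * f₂ x) x)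
    (h₁ : f₁ (-1) = 0) (h₂ : f₂ 1 = 0) (hf : f₁ 0 = f₂ 0) (hg : g₁ 0 = g₂ 0)
    (hB₁ : ∀ x ∈ Icc (-1 : ℝ) 0, ‖f₁ x‖ ≤ B) (hB₂ : ∀ x ∈ Icc (0 : ℝ) 1, ‖f₂ x‖ ≤ B) :
    ∃ (U : H10) (F : H1),
      (F : L2) = weakDeriv₀ U + dampMul p (weakDeriv₀ ((Complex.I * l) • U)) ∧
      weakDeriv F = Φ - (l : ℂ) ^ 2 • (U : L2) ∧ ‖(U : L2)‖ ≤ √2 * B := by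
  have cont {f g : ℝ → ℂ} (h : ∀ x, HasDerivAt f (g x) x) : Continuous f :=
    continuous_iff_continuousAt.2 fun x => (h x).continuousAt
  have hUm := memLp_glue (cont hf₁) (cont hf₂)
  have hUxm := memLp_glue (cont hg₁) ((cont hg₂).const_mul (dampFactor p.d l)⁻¹)
  have hFm := memLp_glue (cont hg₁) (cont hg₂)
  have hU : IsWeakDeriv hUm.toLp hUxm.toLp :=
    isWeakDeriv_of_glue hf₁ hf₂ hf hUm.coeFn_toLp hUxm.coeFn_toLp
  have hF : IsWeakDeriv hFm.toLp (Φ - (l : ℂ) ^ 2 • hUm.toLp) := by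
    refine isWeakDeriv_of_glue hg₁ hg₂ hg hFm.coeFn_toLp ?_
    filter_upwards [Lp.coeFn_sub Φ ((l : ℂ) ^ 2 • hUm.toLp),
      Lp.coeFn_smul ((l : ℂ) ^ 2) hUm.toLp, hΦ, hUm.coeFn_toLp] with x hsub hsmul hφ hux
    rw [hsub, Pi.sub_apply, hsmul, Pi.smul_apply, hφ, hux, smul_eq_mul]
    rcases le_or_gt 0 x with h | h
    · rw [glue_of_nonneg h, glue_of_nonneg h]
    · rw [glue_of_neg h, glue_of_neg h]
  have hU₀ : hUm.toLp ∈ H10 := ⟨⟨_, hU⟩, _, (continuous_glue (cont hf₁) (cont hf₂) hf).continuousOn,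
      hUm.coeFn_toLp, by rw [glue_of_neg (by norm_num), h₁],
      by rw [glue_of_nonneg (by norm_num), h₂]⟩
  refine ⟨⟨_, hU₀⟩, ⟨_, _, hF⟩, ?_, weakDeriv_eq hF, norm_le_of_glue hUm.coeFn_toLp hB₁ hB₂⟩
  rw [map_smul, weakDeriv₀_eq hU]
  exact eq_add_dampMul_of_glue hFm.coeFn_toLp hUxm.coeFn_toLp

end ApproximateEigenvectors

section Transmission

theorem norm_sinh_le (z : ℂ) : ‖Complex.sinh z‖ ≤ Real.cosh z.re := by
  have h := norm_sub_le (Complex.exp z) (Complex.exp (-z))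
  rw [Complex.norm_exp, Complex.norm_exp, Complex.neg_re] at h
  rw [Complex.sinh, norm_div, Complex.norm_ofNat, Real.cosh_eq]
  linarith

theorem sinh_re_le_norm_sinh (z : ℂ) : Real.sinh z.re ≤ ‖Complex.sinh z‖ := by
  have h := norm_sub_norm_le (Complex.exp z) (Complex.exp (-z))
  rw [Complex.norm_exp, Complex.norm_exp, Complex.neg_re] at h
  rw [Complex.sinh, norm_div, Complex.norm_ofNat, Real.sinh_eq]
  linarith

theorem sinh_re_le_norm_cosh (z : ℂ) : Real.sinh z.re ≤ ‖Complex.cosh z‖ := by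
  have h := norm_sub_le_norm_add (Complex.exp z) (Complex.exp (-z))
  rw [Complex.norm_exp, Complex.norm_exp, Complex.neg_re] at h
  rw [Complex.cosh, norm_div, Complex.norm_ofNat, Real.sinh_eq]
  linarith

theorem cosh_le_two_mul_sinh {a : ℝ} (ha : 1 ≤ a) : Real.cosh a ≤ 2 * Real.sinh a := by
  have h1 : 3 ≤ Real.exp (2 * a) := by linarith [Real.add_one_le_exp (2 * a)]
  have h2 : Real.exp (2 * a) * Real.exp (-a) = Real.exp a := by
    rw [← Real.exp_add]
    ring_nf
  have h3 := mul_le_mul_of_nonneg_right h1 (Real.exp_pos (-a)).le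
  rw [Real.cosh_eq, Real.sinh_eq]
  linarith

theorem norm_sinh_pos {z : ℂ} (hz : 0 < z.re) : 0 < ‖Complex.sinh z‖ :=
  (Real.sinh_pos_iff.2 hz).trans_le (sinh_re_le_norm_sinh z)

theorem half_le_norm_cosh_div_sinh {z : ℂ} (hz : 1 ≤ z.re) :
    1 / 2 ≤ ‖Complex.cosh z / Complex.sinh z‖ := by
  rw [norm_div, le_div_iff₀ (norm_sinh_pos (zero_lt_one.trans_le hz))]
  linarith [norm_sinh_le z, cosh_le_two_mul_sinh hz, sinh_re_le_norm_cosh z]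

theorem norm_sinh_mul_le {z : ℂ} (hz : 1 ≤ z.re) {t : ℝ} (ht : t ∈ Icc (0 : ℝ) 1) :
    ‖Complex.sinh (z * t)‖ ≤ 2 * ‖Complex.sinh z‖ :=
  have hz0 : 0 ≤ z.re := zero_le_one.trans hz
  calc ‖Complex.sinh (z * t)‖ ≤ Real.cosh (z.re * t) := by
        simpa only [Complex.re_mul_ofReal] using norm_sinh_le (z * t)
    _ ≤ Real.cosh z.re := by
        rw [Real.cosh_le_cosh, abs_of_nonneg (mul_nonneg hz0 ht.1), abs_of_nonneg hz0]
        exact mul_le_of_le_one_right hz0 ht.2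
    _ ≤ 2 * Real.sinh z.re := cosh_le_two_mul_sinh hz
    _ ≤ 2 * ‖Complex.sinh z‖ := by gcongr; exact sinh_re_le_norm_sinh z

theorem norm_sin_ofReal_le (x : ℝ) : ‖Complex.sin (x : ℂ)‖ ≤ 1 := by
  rw [← Complex.ofReal_sin, Complex.norm_real, Real.norm_eq_abs]
  exact Real.abs_sin_le_one x

/-- The rate `μ`, of nonnegative real part, such that `sinh (μ (1 - x))` solves the damped
equation `dampFactor d l * u'' = -l² u`. -/
def decayRate (d l : ℝ) : ℂ := (-(l : ℂ) ^ 2 / dampFactor d l) ^ (2⁻¹ : ℂ)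

/-- The determinant of the transmission conditions at `0` for a displacement proportional to
`sin (l (x + 1))` on `(-1, 0)` and to `sinh (μ (1 - x)) / sinh μ` on `(0, 1)`, where `μ` is the
decay rate. -/
def transmissionDet (d l : ℝ) : ℂ :=
  l * Complex.cos l + dampFactor d l * decayRate d l *
    (Complex.cosh (decayRate d l) / Complex.sinh (decayRate d l)) * Complex.sin l

variable {d k l : ℝ}

theorem le_norm_dampFactor (d l : ℝ) : l * d ≤ ‖dampFactor d l‖ := by
  rw [← dampFactor_im]
  exact (le_abs_self _).trans (Complex.abs_im_le_norm _)

theorem norm_dampFactor_le (h : 1 ≤ l * d) : ‖dampFactor d l‖ ≤ 2 * (l * d) := by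
  refine (norm_add_le _ _).trans ?_
  rw [norm_one, mul_assoc, ← Complex.ofReal_mul, norm_mul, Complex.norm_I, Complex.norm_real,
    Real.norm_of_nonneg (zero_le_one.trans h)]
  linarith

theorem dampFactor_mul_decayRate_sq (d l : ℝ) :
    dampFactor d l * decayRate d l ^ 2 = -(l : ℂ) ^ 2 := by
  rw [decayRate, Complex.cpow_ofNat_inv_pow, mul_div_cancel₀ _ (dampFactor_ne_zero d l)]

theorem norm_dampFactor_mul_norm_decayRate_sq (d l : ℝ) :
    ‖dampFactor d l‖ * ‖decayRate d l‖ ^ 2 = l ^ 2 := by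
  rw [← norm_pow, ← norm_mul, dampFactor_mul_decayRate_sq, norm_neg, norm_pow, Complex.norm_real,
    Real.norm_eq_abs, sq_abs]

theorem one_le_re_decayRate (hd : 0 < d) (h : 4 * d ^ 2 + 2 ≤ l * d) :
    1 ≤ (decayRate d l).re := by
  have hl : 0 < l := pos_of_mul_pos_left (by nlinarith) hd.le
  have hD : ‖dampFactor d l‖ ≠ 0 := norm_ne_zero_iff.2 (dampFactor_ne_zero d l)
  have hnorm : l / (2 * d) ≤ ‖-(l : ℂ) ^ 2 / dampFactor d l‖ := by
    rw [norm_div, norm_neg, norm_pow, Complex.norm_real, Real.norm_of_nonneg hl.le,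
      div_le_div_iff₀ (by positivity) (by positivity)]
    nlinarith [norm_dampFactor_le (d := d) (l := l) (by nlinarith)]
  have hre : -(1 / d ^ 2) ≤ (-(l : ℂ) ^ 2 / dampFactor d l).re := by
    have : (-(l : ℂ) ^ 2 / dampFactor d l).re = -(l ^ 2 / (1 + (l * d) ^ 2)) := by
      rw [← Complex.ofReal_pow, ← Complex.ofReal_neg, Complex.div_re, Complex.normSq_apply,
        dampFactor_re, dampFactor_im, Complex.ofReal_re, Complex.ofReal_im]
      ring
    rw [this, neg_le_neg_iff, div_le_div_iff₀ (by positivity) (by positivity)]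
    linarith
  have hsum : 2 ≤ l / (2 * d) - 1 / d ^ 2 := by
    rw [div_sub_div _ _ (by positivity) (by positivity), le_div_iff₀ (by positivity)]
    nlinarith
  rw [decayRate, Complex.cpow_inv_two_re, Real.one_le_sqrt]
  linarith

theorem mul_sqrt_le_norm_dampFactor_mul_decayRate (hl : 0 ≤ l) (hd : 0 ≤ d) :
    l * √(l * d) ≤ ‖dampFactor d l * decayRate d l‖ := by
  rw [← sq_le_sq₀ (by positivity) (norm_nonneg _)]
  calc (l * √(l * d)) ^ 2 = l * d * l ^ 2 := by
        rw [mul_pow, Real.sq_sqrt (by positivity), mul_comm]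
    _ ≤ ‖dampFactor d l‖ * l ^ 2 := by gcongr; exact le_norm_dampFactor d l
    _ = ‖dampFactor d l * decayRate d l‖ ^ 2 := by
        rw [← norm_dampFactor_mul_norm_decayRate_sq d l, norm_mul]
        ring

theorem le_norm_transmissionDet (hd : 0 < d) (h : 4 * d ^ 2 + 2 ≤ l * d)
    (hs : 4 ≤ √(l * d) * |Real.sin l|) : l ≤ ‖transmissionDet d l‖ := by
  have hl : 0 ≤ l := (pos_of_mul_pos_left (by nlinarith) hd.le).le
  have hcos : ‖(l : ℂ) * Complex.cos l‖ ≤ l := by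
    rw [← Complex.ofReal_cos, norm_mul, Complex.norm_real, Complex.norm_real,
      Real.norm_of_nonneg hl, Real.norm_eq_abs]
    exact mul_le_of_le_one_right hl (Real.abs_cos_le_one l)
  have hsin : 2 * l ≤ ‖dampFactor d l * decayRate d l *
      (Complex.cosh (decayRate d l) / Complex.sinh (decayRate d l)) * Complex.sin l‖ := by
    rw [norm_mul, norm_mul, ← Complex.ofReal_sin, Complex.norm_real, Real.norm_eq_abs]
    calc 2 * l = l * (1 / 2) * 4 := by ring
      _ ≤ l * (1 / 2) * (√(l * d) * |Real.sin l|) := by gcongr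
      _ = l * √(l * d) * (1 / 2) * |Real.sin l| := by ring
      _ ≤ _ := by
        gcongr
        · exact mul_sqrt_le_norm_dampFactor_mul_decayRate hl hd.le
        · exact half_le_norm_cosh_div_sinh (one_le_re_decayRate hd h)
  have htri := norm_sub_le_norm_add (dampFactor d l * decayRate d l *
    (Complex.cosh (decayRate d l) / Complex.sinh (decayRate d l)) * Complex.sin l)
    (l * Complex.cos l)
  rw [add_comm (_ * Complex.sin (l : ℂ))] at htri
  rw [transmissionDet]
  linarith

theorem abs_sq_sub_sq_le_norm_sq_sub_dampFactor_mul_sq (d k l : ℝ) :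
    |l ^ 2 - k ^ 2| ≤ ‖(l : ℂ) ^ 2 - dampFactor d l * k ^ 2‖ := by
  have hre : ((l : ℂ) ^ 2 - dampFactor d l * k ^ 2).re = l ^ 2 - k ^ 2 := by
    rw [← Complex.ofReal_pow, ← Complex.ofReal_pow, Complex.sub_re, Complex.re_mul_ofReal,
      Complex.ofReal_re, dampFactor_re, one_mul]
  exact hre ▸ Complex.abs_re_le_norm _

theorem mul_sq_le_norm_sq_sub_dampFactor_mul_sq (d k l : ℝ) :
    l * d * k ^ 2 ≤ ‖(l : ℂ) ^ 2 - dampFactor d l * k ^ 2‖ := by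
  have him : ((l : ℂ) ^ 2 - dampFactor d l * k ^ 2).im = -(l * d * k ^ 2) := by
    rw [← Complex.ofReal_pow, ← Complex.ofReal_pow, Complex.sub_im, Complex.im_mul_ofReal,
      Complex.ofReal_im, dampFactor_im, zero_sub]
  rw [← neg_neg (l * d * k ^ 2), ← him]
  exact (neg_le_abs _).trans (Complex.abs_im_le_norm _)

theorem norm_dampFactor_mul_div_mul_le (hk : 0 < k) (h : 1 ≤ l * d) :
    ‖dampFactor d l * (Complex.I / (l ^ 2 - dampFactor d l * k ^ 2)) * k‖ ≤ 2 / k := by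
  have hld : 0 < l * d := zero_lt_one.trans_le h
  rw [norm_mul, norm_mul, norm_div, Complex.norm_I, Complex.norm_real, Real.norm_of_nonneg hk.le]
  calc _ ≤ 2 * (l * d) * (1 / (l * d * k ^ 2)) * k := by
        gcongr
        · exact norm_dampFactor_le h
        · exact mul_sq_le_norm_sq_sub_dampFactor_mul_sq d k l
    _ = 2 / k := by
        have hl := left_ne_zero_of_mul hld.ne'
        have hd := right_ne_zero_of_mul hld.ne'
        field_simp

theorem exists_transmission_coefficients (hd : 0 < d) (hk : 0 < k) (hlk : l ^ 2 - k ^ 2 ≠ 0)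
    (h : 4 * d ^ 2 + 2 ≤ l * d) (hs : 4 ≤ √(l * d) * |Real.sin l|) :
    ∃ α β γ δ : ℂ, β * (l ^ 2 - k ^ 2) = Complex.I ∧
      γ * (l ^ 2 - dampFactor d l * k ^ 2) = Complex.I ∧
      α * Complex.sin l = δ * Complex.sinh (decayRate d l) ∧
      β * k + α * l * Complex.cos l = dampFactor d l *
        (γ * k - δ * decayRate d l * Complex.cosh (decayRate d l)) ∧
      ‖β‖ ≤ 1 / |l ^ 2 - k ^ 2| ∧ ‖γ‖ ≤ 1 / |l ^ 2 - k ^ 2| ∧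
      ‖α‖ ≤ (2 / k + k / |l ^ 2 - k ^ 2|) / l := by
  have hl : 0 < l := pos_of_mul_pos_left (by nlinarith) hd.le
  have hsinh : Complex.sinh (decayRate d l) ≠ 0 := norm_pos_iff.1
    (norm_sinh_pos (zero_lt_one.trans_le (one_le_re_decayRate hd h)))
  have hdet := le_norm_transmissionDet hd h hs
  have hdet0 : transmissionDet d l ≠ 0 := norm_pos_iff.1 (hl.trans_le hdet)
  have hβ0 : (l : ℂ) ^ 2 - k ^ 2 ≠ 0 := by exact_mod_cast hlk
  have hnorm := abs_sq_sub_sq_le_norm_sq_sub_dampFactor_mul_sq d k l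
  have hγ0 := norm_pos_iff.1 ((abs_pos.2 hlk).trans_le hnorm)
  set β : ℂ := Complex.I / (l ^ 2 - k ^ 2) with hβ
  set γ : ℂ := Complex.I / (l ^ 2 - dampFactor d l * k ^ 2) with hγ
  set α : ℂ := (dampFactor d l * γ * k - k * β) / transmissionDet d l with hα
  have hβn : ‖β‖ = 1 / |l ^ 2 - k ^ 2| := by
    rw [hβ, norm_div, Complex.norm_I, ← Real.norm_eq_abs, ← Complex.norm_real]
    push_cast
    rfl
  refine ⟨α, β, γ, α * Complex.sin l / Complex.sinh (decayRate d l), div_mul_cancel₀ _ hβ0,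
    div_mul_cancel₀ _ hγ0, (div_mul_cancel₀ _ hsinh).symm, ?_, hβn.le, ?_, ?_⟩
  · have hαdet : α * transmissionDet d l = dampFactor d l * γ * k - k * β :=
      div_mul_cancel₀ _ hdet0
    rw [transmissionDet] at hαdet
    linear_combination hαdet
  · rw [hγ, norm_div, Complex.norm_I]
    exact one_div_le_one_div_of_le (abs_pos.2 hlk) hnorm
  · rw [hα, norm_div]
    refine div_le_div₀ (by positivity) ((norm_sub_le _ _).trans (add_le_add ?_ ?_)) hl hdet
    · exact norm_dampFactor_mul_div_mul_le hk (by nlinarith)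
    · rw [norm_mul, Complex.norm_real, Real.norm_of_nonneg hk.le, hβn, mul_one_div]

end Transmission

section Instability

variable {p : Params} {k l : ℝ}

theorem hasDerivAt_sin_shift (l x : ℝ) :
    HasDerivAt (fun x : ℝ => Complex.sin (l * (x + 1))) (l * Complex.cos (l * (x + 1))) x := by
  simpa only [Complex.ofReal_add, Complex.ofReal_one] using
    (hasDerivAt_sin_mul l (x + 1)).comp_add_const x 1

theorem hasDerivAt_cos_shift (l x : ℝ) :
    HasDerivAt (fun x : ℝ => Complex.cos (l * (x + 1))) (-l * Complex.sin (l * (x + 1))) x := by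
  simpa only [Complex.ofReal_add, Complex.ofReal_one] using
    (hasDerivAt_cos_mul l (x + 1)).comp_add_const x 1

theorem hasDerivAt_mul_one_sub (μ : ℂ) (x : ℝ) :
    HasDerivAt (fun x : ℝ => μ * ((1 - x : ℝ) : ℂ)) (-μ) x := by
  simpa using ((hasDerivAt_id x).const_sub 1).ofReal_comp.const_mul μ

theorem hasDerivAt_sinh_mul_one_sub (μ : ℂ) (x : ℝ) :
    HasDerivAt (fun x : ℝ => Complex.sinh (μ * ((1 - x : ℝ) : ℂ)))
      (-μ * Complex.cosh (μ * ((1 - x : ℝ) : ℂ))) x := by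
  rw [mul_comm (-μ)]
  exact (Complex.hasDerivAt_sinh _).comp x (hasDerivAt_mul_one_sub μ x)

theorem hasDerivAt_cosh_mul_one_sub (μ : ℂ) (x : ℝ) :
    HasDerivAt (fun x : ℝ => Complex.cosh (μ * ((1 - x : ℝ) : ℂ)))
      (-μ * Complex.sinh (μ * ((1 - x : ℝ) : ℂ))) x := by
  rw [mul_comm (-μ)]
  exact (Complex.hasDerivAt_cosh _).comp x (hasDerivAt_mul_one_sub μ x)

theorem norm_mul_sin_add_mul_sin_le (α β : ℂ) (k l x y : ℝ) :
    ‖β * Complex.sin (k * x) + α * Complex.sin (l * y)‖ ≤ ‖β‖ + ‖α‖ := by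
  rw [← Complex.ofReal_mul, ← Complex.ofReal_mul]
  refine (norm_add_le _ _).trans (add_le_add ?_ ?_) <;>
  · rw [norm_mul]
    exact mul_le_of_le_one_right (norm_nonneg _) (norm_sin_ofReal_le _)

theorem norm_mul_sin_add_mul_sinh_le {α γ δ μ : ℂ} (hμ : 1 ≤ μ.re) {x y t : ℝ}
    (hδ : α * Complex.sin y = δ * Complex.sinh μ) (ht : t ∈ Icc (0 : ℝ) 1) :
    ‖γ * Complex.sin (k * x) + δ * Complex.sinh (μ * t)‖ ≤ ‖γ‖ + 2 * ‖α‖ := by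
  refine (norm_add_le _ _).trans (add_le_add ?_ ?_)
  · rw [norm_mul, ← Complex.ofReal_mul]
    exact mul_le_of_le_one_right (norm_nonneg _) (norm_sin_ofReal_le _)
  · calc ‖δ * Complex.sinh (μ * t)‖ ≤ ‖δ‖ * (2 * ‖Complex.sinh μ‖) := by
          rw [norm_mul]
          gcongr
          exact norm_sinh_mul_le hμ ht
      _ = 2 * (‖α‖ * ‖Complex.sin y‖) := by
          rw [← norm_mul α, hδ, norm_mul]
          ring
      _ ≤ 2 * (‖α‖ * 1) := by
          gcongr
          exact norm_sin_ofReal_le y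
      _ = 2 * ‖α‖ := by rw [mul_one]

theorem hasDerivAt_undamped_flux {α β : ℂ} (hβ : β * (l ^ 2 - k ^ 2) = Complex.I) (x : ℝ) :
    HasDerivAt
      (fun x : ℝ => β * (k * Complex.cos (k * x)) + α * (l * Complex.cos (l * (x + 1))))
      (Complex.I * Complex.sin (k * x) -
        l ^ 2 * (β * Complex.sin (k * x) + α * Complex.sin (l * (x + 1)))) x := by
  refine ((((hasDerivAt_cos_mul k x).const_mul (k : ℂ)).const_mul β).add
    (((hasDerivAt_cos_shift l x).const_mul (l : ℂ)).const_mul α)).congr_deriv ?_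
  linear_combination Complex.sin (k * x) * hβ

theorem hasDerivAt_damped_flux {γ δ D μ : ℂ} (hμ : D * μ ^ 2 = -(l : ℂ) ^ 2)
    (hγ : γ * (l ^ 2 - D * k ^ 2) = Complex.I) (x : ℝ) :
    HasDerivAt
      (fun x : ℝ => D * (γ * (k * Complex.cos (k * x)) +
        δ * (-μ * Complex.cosh (μ * ((1 - x : ℝ) : ℂ)))))
      (Complex.I * Complex.sin (k * x) -
        l ^ 2 * (γ * Complex.sin (k * x) + δ * Complex.sinh (μ * ((1 - x : ℝ) : ℂ)))) x := by
  refine (((((hasDerivAt_cos_mul k x).const_mul (k : ℂ)).const_mul γ).add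
    (((hasDerivAt_cosh_mul_one_sub μ x).const_mul (-μ)).const_mul δ)).const_mul D).congr_deriv ?_
  linear_combination Complex.sin (k * x) * hγ + δ * Complex.sinh (μ * ((1 - x : ℝ) : ℂ)) * hμ

theorem exists_small_transmission_solution (hk0 : 0 < k) (hk : Real.sin k = 0)
    (hlk : l ^ 2 - k ^ 2 ≠ 0) (h : 4 * p.d ^ 2 + 2 ≤ l * p.d)
    (hs : 4 ≤ √(l * p.d) * |Real.sin l|) :
    ∃ (U : H10) (F : H1),
      (F : L2) = weakDeriv₀ U + dampMul p (weakDeriv₀ ((Complex.I * l) • U)) ∧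
      weakDeriv F = Complex.I • sinL2 k - (l : ℂ) ^ 2 • (U : L2) ∧
      ‖(U : L2)‖ ≤
        √2 * (1 / |l ^ 2 - k ^ 2| + 2 * ((2 / k + k / |l ^ 2 - k ^ 2|) / l)) := by
  obtain ⟨α, β, γ, δ, hβ, hγ, hδ, hflux, hβn, hγn, hαn⟩ :=
    exists_transmission_coefficients p.d_pos hk0 hlk h hs
  have hsk : Complex.sin k = 0 := by rw [← Complex.ofReal_sin, hk, Complex.ofReal_zero]
  have hΦ : Complex.I • sinL2 k =ᵐ[mu] fun x => Complex.I * Complex.sin (k * x) := by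
    filter_upwards [Lp.coeFn_smul Complex.I (sinL2 k), sinL2_coeFn k] with x hsmul hsin
    rw [hsmul, Pi.smul_apply, hsin, smul_eq_mul]
  refine exists_mem_H10_of_transmission hΦ
    (fun x => ((hasDerivAt_sin_mul k x).const_mul β).add
      ((hasDerivAt_sin_shift l x).const_mul α))
    (fun x => (((hasDerivAt_sin_mul k x).const_mul γ).add
      ((hasDerivAt_sinh_mul_one_sub (decayRate p.d l) x).const_mul δ)).congr_deriv
      (inv_mul_cancel_left₀ (dampFactor_ne_zero p.d l) _).symm)
    (hasDerivAt_undamped_flux hβ)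
    (hasDerivAt_damped_flux (dampFactor_mul_decayRate_sq p.d l) hγ)
    ?_ ?_ ?_ ?_ (fun x _ => ?_) (fun x hx => ?_)
  · simp [hsk]
  · simp [hsk]
  · simp [hδ]
  · simp only [Complex.ofReal_zero, mul_zero, Complex.cos_zero, mul_one, zero_add, sub_zero,
      Complex.ofReal_one]
    linear_combination hflux
  · have hsin := norm_mul_sin_add_mul_sin_le α β k l x (x + 1)
    rw [Complex.ofReal_add, Complex.ofReal_one] at hsin
    refine hsin.trans ?_
    linarith [norm_nonneg α]
  · refine (norm_mul_sin_add_mul_sinh_le (one_le_re_decayRate p.d_pos h) hδ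
      ⟨sub_nonneg.2 hx.2, sub_le_self 1 hx.1⟩).trans ?_
    linarith

theorem sqrt_mul_abs_sin_lt_four {K : ℝ} (hK0 : 0 ≤ K)
    (hK : ∀ x y, (x, y) ∈ (waveOp p).graph → ∀ l : ℝ, ‖x‖ ≤ K * ‖y - (Complex.I * l) • x‖)
    (hc : p.c ≠ 1) (hk0 : 0 < k) (hk : Real.sin k = 0)
    (hkK : K * (√2 * (√p.c / |p.c - 1| + 2 * (2 + 1 / |p.c - 1|))) < k)
    (h : 4 * p.d ^ 2 + 2 ≤ √p.c * k * p.d) :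
    √(√p.c * k * p.d) * |Real.sin (√p.c * k)| < 4 := by
  by_contra! hs
  have hsc : 0 < √p.c := Real.sqrt_pos.2 p.c_pos
  have : 0 < |p.c - 1| := abs_pos.2 (sub_ne_zero.2 hc)
  have hkl : p.c * k ^ 2 = (√p.c * k) ^ 2 := by rw [mul_pow, Real.sq_sqrt p.c_pos.le]
  have hdiff : (√p.c * k) ^ 2 - k ^ 2 = (p.c - 1) * k ^ 2 := by
    rw [← hkl]
    ring
  obtain ⟨U, F, hF, hF', hU⟩ := exists_small_transmission_solution hk0 hk
    (by rw [hdiff]; exact mul_ne_zero (sub_ne_zero.2 hc) (by positivity)) h hs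
  rw [hdiff, abs_mul, abs_of_pos (pow_pos hk0 2)] at hU
  have hlt : (1 : ℝ) < 1 :=
    calc 1 ≤ K * (√p.c * k * ‖(U : L2)‖) :=
          one_le_mul_norm_of_resolvent_bound hK (by positivity) hk0.ne' hk hkl hF hF'
      _ ≤ K * (√p.c * k * (√2 * (1 / (|p.c - 1| * k ^ 2) +
            2 * ((2 / k + k / (|p.c - 1| * k ^ 2)) / (√p.c * k))))) := by gcongr
      _ = K * (√2 * (√p.c / |p.c - 1| + 2 * (2 + 1 / |p.c - 1|))) / k := by field_simp
      _ < 1 := (div_lt_one hk0).2 hkK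
  exact lt_irrefl _ hlt

theorem isBigO_rpow_neg_half {f : ℕ → ℝ} {a B : ℝ} (ha : 0 < a)
    (h : ∀ᶠ n : ℕ in atTop, √(a * n) * |f n| ≤ B) :
    f =O[atTop] fun n : ℕ => (n : ℝ) ^ (-(1 / 2) : ℝ) := by
  refine IsBigO.of_bound (B / √a) ?_
  filter_upwards [h, eventually_gt_atTop 0] with n hn hn0
  have hn0 : (0 : ℝ) < n := Nat.cast_pos.2 hn0
  rw [Real.rpow_neg hn0.le, ← Real.sqrt_eq_rpow, norm_inv, Real.norm_of_nonneg (Real.sqrt_nonneg _),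
    ← div_eq_mul_inv, div_div, ← Real.sqrt_mul ha.le, le_div_iff₀ (Real.sqrt_pos.2 (by positivity)),
    mul_comm, Real.norm_eq_abs]
  exact hn

theorem isBigO_sin_of_expStable {S : C0Semigroup (Energy p)} (hS : S.HasGenerator (waveOp p))
    (h : S.ExpStable) :
    (fun n : ℕ => Real.sin (2 * √p.c * n * Real.pi)) =O[atTop]
      fun n : ℕ => (n : ℝ) ^ (-(1 / 2) : ℝ) := by
  have hsin (n : ℕ) : Real.sin (2 * n * Real.pi) = 0 := mod_cast Real.sin_nat_mul_pi (2 * n)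
  by_cases hc : p.c = 1
  · simpa only [hc, Real.sqrt_one, mul_one, hsin] using isBigO_zero _ _
  obtain ⟨K, hK0, hK⟩ := h.exists_norm_le hS
  have hd := p.d_pos
  have hsc : 0 < √p.c := Real.sqrt_pos.2 p.c_pos
  have hk : Tendsto (fun n : ℕ => 2 * (n : ℝ) * Real.pi) atTop atTop :=
    (tendsto_natCast_atTop_atTop.const_mul_atTop two_pos).atTop_mul_const Real.pi_pos
  refine isBigO_rpow_neg_half (a := 2 * √p.c * Real.pi * p.d) (B := 4) (by positivity) ?_
  filter_upwards [hk.eventually_gt_atTop 0, hk.eventually_gt_atTop _,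
    ((hk.const_mul_atTop hsc).atTop_mul_const hd).eventually_ge_atTop _] with n hn0 hnK hnd
  have hl : 2 * √p.c * n * Real.pi = √p.c * (2 * n * Real.pi) := by ring
  have hld : 2 * √p.c * Real.pi * p.d * n = √p.c * (2 * n * Real.pi) * p.d := by ring
  rw [hl, hld]
  exact (sqrt_mul_abs_sin_lt_four hK0 hK hc hn0 (hsin n) hnK hnd).le

end Instability

end KVWave

end

theorem theorem3p1_general (p : KVWave.Params)
    (hsin : ¬ (fun n : ℕ => Real.sin (2 * √p.c * n * Real.pi)) =O[atTop]
      fun n : ℕ => (n : ℝ) ^ (-(1 / 2) : ℝ)) :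
    (∃ S : KVWave.C0Semigroup (KVWave.Energy p), S.HasGenerator (KVWave.waveOp p)) ∧
    ∀ S : KVWave.C0Semigroup (KVWave.Energy p), S.HasGenerator (KVWave.waveOp p) →
      ¬ S.ExpStable :=
  ⟨KVWave.exists_hasGenerator_waveOp p,
    fun _ hS hstable => hsin (KVWave.isBigO_sin_of_expStable hS hstable)⟩

/-- If `c > 1` and `sin(2√c nπ)` is not `O(n^{-1/2})`, then the operator `𝒜` generates a
`C₀`-semigroup on the energy space, and the semigroup generated by `𝒜` is not exponentially
stable. -/
theorem theorem3p1 (p : KVWave.Params) (hc : 1 < p.c)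
    (hsin : ¬ (fun n : ℕ => Real.sin (2 * √p.c * n * Real.pi)) =O[atTop]
      fun n : ℕ => (n : ℝ) ^ (-(1 / 2) : ℝ)) :
    (∃ S : KVWave.C0Semigroup (KVWave.Energy p), S.HasGenerator (KVWave.waveOp p)) ∧
    ∀ S : KVWave.C0Semigroup (KVWave.Energy p), S.HasGenerator (KVWave.waveOp p) →
      ¬ S.ExpStable :=
  theorem3p1_general p hsin
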